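/- **Setting.** Let $M\subseteq B(K)$ be a von Neumann algebra and let $E$ be a $W^*$-correspondence over $M$: a self-dual Hilbert $C^*$-module over $M$ (inner product linear in the second variable) with a left action given by a normal $*$-homomorphism $\varphi:M\to\mathcal L(E)$ into the adjointable operators. Let $\mathcal F(E)=M\oplus E\oplus E^{\otimes 2}\oplus\cdots$ be the full Fock correspondence (as a self-dual module), let $T_\xi\zeta=\xi\otimes\zeta$ ($\xi\in E$) be the creation operators and $\varphi_\infty(a)=\mathrm{diag}(a,\varphi(a),\varphi^{(2)}(a),\dots)$ ($a\in M$) the left action of $M$ on $\mathcal F(E)$. The tensor algebra $\mathcal T_+(E)$ is the norm closed subalgebra of $\mathcal L(\mathcal F(E))$ generated by all $T_\xi$ and $\varphi_\infty(a)$, and the Hardy algebra $H^\infty(E)$ is the ultraweak closure of $\mathcal T_+(E)$ in $\mathcal L(\mathcal F(E))$. Let $\sigma$ be a faithful normal representation of $M$ on a Hilbert space $H$ with $\sigma(1)=I$, and let $E\otimes_\sigma H$ be the Hilbert space completion of the algebraic tensor product in which $\langle\xi\otimes h,\zeta\otimes k\rangle=\langle h,\sigma(\langle\xi,\zeta\rangle)k\rangle$.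 The $\sigma$-dual of $E$ is $$E^\sigma=\{\eta\in B(H,E\otimes_\sigma H)\;:\;\eta\,\sigma(a)=(\varphi(a)\otimes I)\,\eta\ \text{ for all } a\in M\},$$ with the operator norm. For $a\in\sigma(M)'$ and $\eta,\zeta\in E^\sigma$ put $a\cdot\eta=(I\otimes a)\eta\in E^\sigma$ and $\langle\eta,\zeta\rangle=\eta^*\zeta\in\sigma(M)'$. Let $\eta^{\otimes k}\in(E^\sigma)^{\otimes k}$ be the $k$-fold tensor power over $\sigma(M)'$; inner products of elementary tensors are computed by $\langle x\otimes x',y\otimes y'\rangle=\langle x',\langle x,y\rangle\cdot y'\rangle$, and $\langle\eta^{\otimes 0},\eta^{\otimes 0}\rangle=I$. **Theorem.** For every $\eta\in E^\sigma$ with $\|\eta\|<1$ there is exactly one ultraweakly continuous algebra homomorphism $\rho_\eta:H^\infty(E)\to B(H)$ such that $$\rho_\eta(T_\xi)h=\eta^*(\xi\otimes h),\qquad \rho_\eta(\varphi_\infty(a))=\sigma(a)\qquad(\xi\in E,\ h\in H,\ a\in M).$$ For $X\in H^\infty(E)$ write $X(\eta^*)=\rho_\eta(X)$. Suppose that $X\in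 H^\infty(E)$ satisfies $\|X\|\le 1$ and $X(0)=0$. Then for every $\eta\in E^\sigma$ with $\|\eta\|<1$: 1. if $a\in\sigma(M)'$ satisfies $a\ge 0$ and $\langle\eta,a\cdot\eta\rangle\le a$, then $X(\eta^*)\,a\,X(\eta^*)^*\le\langle\eta,a\cdot\eta\rangle$; 2. for every integer $k\ge 0$, $X(\eta^*)\,\langle\eta^{\otimes k},\eta^{\otimes k}\rangle\,X(\eta^*)^*\le\langle\eta^{\otimes (k+1)},\eta^{\otimes (k+1)}\rangle$; 3. $X(\eta^*)X(\eta^*)^*\le\langle\eta,\eta\rangle$. -/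

import Mathlib

open scoped InnerProductSpace Topology
universe u v w

noncomputable section
namespace Hardy

section VonNeumann
variable {K : Type u} [NormedAddCommGroup K] [InnerProductSpace ℂ K] [CompleteSpace K]

/-- The `C⋆`-algebra of elements of a von Neumann algebra `M ⊆ B(K)`. -/
abbrev Elem (M : VonNeumannAlgebra K) : Type u := ↥M.toStarSubalgebra

theorem mem_iff (M : VonNeumannAlgebra K) (x : K →L[ℂ] K) :
    x ∈ M.toStarSubalgebra ↔ ∀ c ∈ M.commutant, c * x = x * c := by
  conv_lhs => rw [← VonNeumannAlgebra.commutant_commutant M]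
  exact VonNeumannAlgebra.mem_commutant_iff

instance isClosed_elem (M : VonNeumannAlgebra K) :
    IsClosed (M.toStarSubalgebra : Set (K →L[ℂ] K)) := by
  have : (M.toStarSubalgebra : Set (K →L[ℂ] K)) =
      ⋂ c ∈ M.commutant, {x : K →L[ℂ] K | c * x = x * c} := by
    ext x
    simp only [SetLike.mem_coe, mem_iff, Set.mem_iInter, Set.mem_ofPred_eq]
  rw [this]
  refine isClosed_biInter fun c _ => isClosed_eq ?_ ?_ <;> fun_prop

instance (M : VonNeumannAlgebra K) : StarOrderedRing (Elem M) := by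
  refine StarOrderedRing.of_nonneg_iff' (fun {x y} h z => ?_) (fun x => ⟨fun hx => ?_, ?_⟩)
  · exact add_le_add_right (show (x : K →L[ℂ] K) ≤ y from h) (z : K →L[ℂ] K)
  · have hx' : (0 : K →L[ℂ] K) ≤ (x : K →L[ℂ] K) := hx
    have hs : CFC.sqrt (x : K →L[ℂ] K) ∈ M.toStarSubalgebra := by
      rw [mem_iff]
      intro c hc
      have h1 : Commute (x : K →L[ℂ] K) c := ((mem_iff M _).1 x.2 c hc).symm
      exact (h1.cfcₙ_nnreal _).symm
    refine ⟨⟨_, hs⟩, Subtype.ext ?_⟩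
    have hsa : star (CFC.sqrt (x : K →L[ℂ] K)) = CFC.sqrt (x : K →L[ℂ] K) :=
      (CFC.sqrt_nonneg _).isSelfAdjoint
    show (x : K →L[ℂ] K) = star (CFC.sqrt (x : K →L[ℂ] K)) * CFC.sqrt (x : K →L[ℂ] K)
    rw [hsa, CFC.sqrt_mul_sqrt_self _ hx']
  · rintro ⟨s, rfl⟩
    show (0 : K →L[ℂ] K) ≤ star (s : K →L[ℂ] K) * (s : K →L[ℂ] K)
    exact star_mul_self_nonneg _

end VonNeumann

section MatrixPos

attribute [local instance] CStarAlgebra.spectralOrder CStarAlgebra.spectralOrderedRing in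
theorem exists_neg_part {B : Type u} [NonUnitalCStarAlgebra B] (a : B) (ha : star a = a) :
    ∃ N D : B, star N = N ∧ N = star D * D ∧ N * a * N = - (star (D * N) * (D * N)) ∧
      (D * N = 0 → ∃ c : B, a = star c * c) := by
  have hsa' : IsSelfAdjoint a := ha
  have hNsa : star a⁻ = a⁻ := (CFC.negPart_nonneg a).isSelfAdjoint
  obtain ⟨D, hD⟩ := CStarAlgebra.nonneg_iff_eq_star_mul_self.1 (CFC.negPart_nonneg a)
  refine ⟨a⁻, D, hNsa, hD, ?_, fun h => ?_⟩
  · conv_lhs => rw [mul_assoc]; enter [2, 1]; rw [← CFC.posPart_sub_negPart a hsa']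
    rw [sub_mul, CFC.posPart_mul_negPart, zero_sub, mul_neg, star_mul, hNsa,
      mul_assoc a⁻ (star D), ← mul_assoc (star D) D, ← hD]
  · rw [← CStarAlgebra.nonneg_iff_eq_star_mul_self, ← CFC.negPart_eq_zero_iff a hsa']
    have h7 : star a⁻ * a⁻ = 0 := by
      rw [hNsa]; nth_rw 1 [hD]; rw [mul_assoc, h, mul_zero]
    exact CStarRing.star_mul_self_eq_zero_iff _ |>.1 h7

/-- A self-adjoint matrix over a `C⋆`-algebra with positive quadratic values is of the form
`C⋆ C`. -/
theorem exists_factor {A : Type u} [CStarAlgebra A] [PartialOrder A] [StarOrderedRing A]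
    {n : Type v} [Fintype n] (a : n → n → A)
    (ha : ∀ x : n → A, 0 ≤ ∑ i, ∑ j, star (x i) * a i j * x j)
    (hsa : ∀ i j, star (a i j) = a j i) :
    ∃ c : n → n → A, ∀ i j, a i j = ∑ k, star (c k i) * c k j := by
  obtain ⟨N, D, hN, hD, h1, h2⟩ := exists_neg_part (B := CStarMatrix n n A)
    (CStarMatrix.ofMatrix a) (by ext i j; exact hsa j i)
  have h0 : D * N = 0 := by
    ext k j
    have e1 : (N * CStarMatrix.ofMatrix a * N) j j =
        ∑ i, ∑ l, star (N i j) * a i l * N l j := by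
      have : ∀ i, N j i = star (N i j) := fun i => by
        conv_lhs => rw [← hN]
        rfl
      simp only [CStarMatrix.mul_apply, Finset.sum_mul, this]
      exact Finset.sum_comm
    have e2 : (star (D * N) * (D * N)) j j = ∑ k, star ((D * N) k j) * (D * N) k j := by
      simp only [CStarMatrix.mul_apply (M := star (D * N))]
      rfl
    have h3 := ha (fun i => N i j)
    rw [← e1, h1, CStarMatrix.neg_apply, e2] at h3
    have h4 : ∀ k ∈ Finset.univ, 0 ≤ star ((D * N) k j) * (D * N) k j :=
      fun k _ => star_mul_self_nonneg _
    have h5 := (Finset.sum_eq_zero_iff_of_nonneg h4).1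
      (le_antisymm (neg_nonneg.1 h3) (Finset.sum_nonneg h4)) k (Finset.mem_univ _)
    exact CStarRing.star_mul_self_eq_zero_iff _ |>.1 h5
  obtain ⟨c, hc⟩ := h2 h0
  refine ⟨c, fun i j => ?_⟩
  have := congrFun (congrFun hc i) j
  simp only [CStarMatrix.mul_apply] at this
  exact this

end MatrixPos
section Modules
variable {K : Type u} [NormedAddCommGroup K] [InnerProductSpace ℂ K] [CompleteSpace K]

/-- A (right) Hilbert `C⋆`-module structure over the von Neumann algebra `M` on a normed space
`E`: a right action `rsmul`, and an `M`-valued inner product `ip`, conjugate linear in the first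
and linear in the second variable, inducing the norm. (Completeness is `[CompleteSpace E]`.) -/
class HilbertModule (M : VonNeumannAlgebra K) (E : Type v) [NormedAddCommGroup E]
    [NormedSpace ℂ E] where
  rsmul : E → Elem M → E
  add_rsmul : ∀ x y a, rsmul (x + y) a = rsmul x a + rsmul y a
  rsmul_add : ∀ x a b, rsmul x (a + b) = rsmul x a + rsmul x b
  rsmul_mul : ∀ x a b, rsmul x (a * b) = rsmul (rsmul x a) b
  rsmul_one : ∀ x, rsmul x 1 = x
  smul_rsmul : ∀ (z : ℂ) x a, rsmul (z • x) a = z • rsmul x a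
  rsmul_smul : ∀ (z : ℂ) x a, rsmul x (z • a) = z • rsmul x a
  ip : E → E → Elem M
  ip_add_right : ∀ x y z, ip x (y + z) = ip x y + ip x z
  ip_smul_right : ∀ (c : ℂ) x y, ip x (c • y) = c • ip x y
  ip_rsmul_right : ∀ x y a, ip x (rsmul y a) = ip x y * a
  star_ip : ∀ x y, star (ip x y) = ip y x
  ip_self_nonneg : ∀ x, 0 ≤ ip x x
  norm_sq_eq : ∀ x, ‖x‖ ^ 2 = ‖ip x x‖

open HilbertModule

section
variable (M : VonNeumannAlgebra K) {E : Type v} [NormedAddCommGroup E] [NormedSpace ℂ E]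
  [HilbertModule M E]

theorem ip_add_left (x y z : E) : ip (M := M) (x + y) z = ip x z + ip y z := by
  rw [← star_ip, ip_add_right, star_add, star_ip, star_ip]

theorem ip_smul_left (c : ℂ) (x y : E) :
    ip (M := M) (c • x) y = (starRingEnd ℂ c) • ip x y := by
  rw [← star_ip, ip_smul_right, star_smul, star_ip]; rfl

theorem ip_rsmul_left (x y : E) (a : Elem M) :
    ip (M := M) (rsmul x a) y = star a * ip x y := by
  rw [← star_ip, ip_rsmul_right, star_mul, star_ip]

/-- `ip x` as a linear map. -/
def ipₗ (x : E) : E →ₗ[ℂ] Elem M where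
  toFun := ip x
  map_add' := ip_add_right x
  map_smul' c := ip_smul_right c x

theorem ip_sum_right {ι : Type*} (s : Finset ι) (x : E) (f : ι → E) :
    ip (M := M) x (∑ i ∈ s, f i) = ∑ i ∈ s, ip x (f i) := map_sum (ipₗ M x) f s

theorem ip_sum_left {ι : Type*} (s : Finset ι) (x : E) (f : ι → E) :
    ip (M := M) (∑ i ∈ s, f i) x = ∑ i ∈ s, ip (f i) x := by
  rw [← star_ip, ip_sum_right, star_sum]; simp only [star_ip]

theorem gram_factor {n : Type w} [Fintype n] (x : n → E) :
    ∃ c : n → n → Elem M, ∀ i j, ip (M := M) (x i) (x j) = ∑ k, star (c k i) * c k j := by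
  refine exists_factor _ (fun v => ?_) (fun i j => star_ip _ _)
  have : ∑ i, ∑ j, star (v i) * ip (M := M) (x i) (x j) * v j =
      ip (∑ i, rsmul (x i) (v i)) (∑ i, rsmul (x i) (v i)) := by
    rw [ip_sum_left]
    refine Finset.sum_congr rfl fun i _ => ?_
    rw [ip_sum_right]
    exact Finset.sum_congr rfl fun j _ => by rw [ip_rsmul_left, ip_rsmul_right, mul_assoc]
  rw [this]
  exact ip_self_nonneg _

variable (E) in
/-- The algebra `𝓛(E)` of bounded adjointable operators on the Hilbert module `E`, with the
operator norm. -/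
def Adjointable : Subalgebra ℂ (E →L[ℂ] E) where
  carrier := {T | ∃ S : E →L[ℂ] E, ∀ x y, ip (M := M) (S x) y = ip x (T y)}
  mul_mem' := by
    rintro T₁ T₂ ⟨S₁, h₁⟩ ⟨S₂, h₂⟩
    exact ⟨S₂ * S₁, fun x y => by
      rw [mul_apply_eq_comp, mul_apply_eq_comp, h₂, h₁]⟩
  add_mem' := by
    rintro T₁ T₂ ⟨S₁, h₁⟩ ⟨S₂, h₂⟩
    exact ⟨S₁ + S₂, fun x y => by
      rw [add_apply, add_apply, ip_add_left, ip_add_right,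
        h₁, h₂]⟩
  algebraMap_mem' c := ⟨(starRingEnd ℂ c) • 1, fun x y => by
    rw [Algebra.algebraMap_eq_smul_one, smul_apply,
      smul_apply, ip_smul_left, ip_smul_right, Complex.conj_conj]
    rfl⟩

end

section Ultraweak

/-- The weak topology on `A` defined by the norm-closed linear span of the set `V` of bounded
functionals. -/
@[reducible] def weakTopology {A : Type v} [SeminormedAddCommGroup A] [NormedSpace ℂ A]
    (V : Set (StrongDual ℂ A)) : TopologicalSpace A :=
  ⨅ f : (Submodule.span ℂ V).topologicalClosure,
    TopologicalSpace.induced (f : A → ℂ) inferInstance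

/-- The ultraweak (`σ`-weak) topology on `B(H)`: its predual is the norm closed span of the vector
functionals `T ↦ ⟪h, T k⟫`. -/
@[reducible] def ultraweak (H : Type v) [NormedAddCommGroup H] [InnerProductSpace ℂ H] :
    TopologicalSpace (H →L[ℂ] H) :=
  weakTopology {f | ∃ h k : H, ∀ T, f T = ⟪h, T k⟫_ℂ}

/-- The ultraweak topology on the von Neumann algebra `M ⊆ B(K)`: its predual is the norm closed
span of the restrictions to `M` of the vector functionals. -/
@[reducible] def ultraweakElem (M : VonNeumannAlgebra K) : TopologicalSpace (Elem M) :=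
  weakTopology {f | ∃ h k : K, ∀ a : Elem M, f a = ⟪h, (a : K →L[ℂ] K) k⟫_ℂ}

/-- The ultraweak topology on `𝓛(E)`, for a Hilbert module `E` over `M`: its predual is
the norm closed span of the functionals `T ↦ ω(⟨x, T y⟩)`, with `x, y ∈ E` and `ω` a vector
functional of `M`. -/
@[reducible] def ultraweakAdj (M : VonNeumannAlgebra K) (E : Type v) [NormedAddCommGroup E] [NormedSpace ℂ E]
    [HilbertModule M E] : TopologicalSpace (Adjointable M E) :=
  weakTopology {f | ∃ (x y : E) (h k : K), ∀ T : Adjointable M E,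
    f T = ⟪h, (ip (M := M) x ((T : E →L[ℂ] E) y) : K →L[ℂ] K) k⟫_ℂ}

end Ultraweak

/-- A `W⋆`-correspondence over `M`: a self-dual Hilbert module over `M` with a left action of `M`
given by a normal `*`-homomorphism `M → 𝓛(E)`. -/
class WStarCorrespondence (M : VonNeumannAlgebra K) (E : Type v) [NormedAddCommGroup E]
    [NormedSpace ℂ E] [CompleteSpace E] extends HilbertModule M E where
  self_dual : ∀ τ : E →L[ℂ] Elem M, (∀ x a, τ (rsmul x a) = τ x * a) → ∃ y, ∀ x, τ x = ip y x
  lact : Elem M →ₙₐ[ℂ] Adjointable M E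
  lact_star : ∀ a x y, (ip ((lact (star a) : E →L[ℂ] E) x) y : Elem M) =
    ip x ((lact a : E →L[ℂ] E) y)
  lact_normal : Continuous[ultraweakElem M, ultraweakAdj M E] lact

end Modules

section Interior
variable {K : Type u} [NormedAddCommGroup K] [InnerProductSpace ℂ K] [CompleteSpace K]
variable (M : VonNeumannAlgebra K) (E : Type v) [NormedAddCommGroup E] [NormedSpace ℂ E]
  [HilbertModule M E]
  {L : Type w} [NormedAddCommGroup L] [InnerProductSpace ℂ L] [CompleteSpace L]
  (π : Elem M →⋆ₙₐ[ℂ] (L →L[ℂ] L))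
open HilbertModule TensorProduct

/-- The algebraic tensor product `E ⊗ L`, to be equipped with the semi-inner product
`⟪ξ ⊗ h, ζ ⊗ k⟫ = ⟪h, π(⟨ξ, ζ⟩) k⟫`. -/
@[nolint unusedArguments]
def PreTensor (_ : Elem M →⋆ₙₐ[ℂ] (L →L[ℂ] L)) : Type (max v w) := E ⊗[ℂ] L

/-- The sesquilinear form on `E ⊗ L` determined by `⟪ξ ⊗ h, ζ ⊗ k⟫ = ⟪h, π(⟨ξ, ζ⟩) k⟫`. -/
def form : E ⊗[ℂ] L →ₗ⋆[ℂ] E ⊗[ℂ] L →ₗ[ℂ] ℂ :=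
  lift (LinearMap.mk₂'ₛₗ (starRingEnd ℂ) (starRingEnd ℂ)
    (fun ξ h => lift (LinearMap.mk₂ ℂ (fun ζ k => ⟪h, π (ip ξ ζ) k⟫_ℂ)
      (by intros; simp [ip_add_right])
      (by intros; simp [ip_smul_right])
      (by intros; simp)
      (by intros; simp)))
    (by intros; ext; simp [ip_add_left])
    (by intros; ext; simp [ip_smul_left])
    (by intros; ext; simp)
    (by intros; ext; simp [mul_comm]))

@[simp]
theorem form_tmul (ξ ζ : E) (h k : L) :
    form M E π (ξ ⊗ₜ h) (ζ ⊗ₜ k) = ⟪h, π (ip ξ ζ) k⟫_ℂ := rfl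

theorem form_symm (x y : E ⊗[ℂ] L) : starRingEnd ℂ (form M E π y x) = form M E π x y := by
  induction x with
  | zero => simp
  | add x₁ x₂ h₁ h₂ => simp only [map_add, LinearMap.add_apply, h₁, h₂]
  | tmul ξ h =>
    induction y with
    | zero => simp
    | add y₁ y₂ h₁ h₂ => simp only [map_add, LinearMap.add_apply, h₁, h₂]
    | tmul ζ k =>
      rw [form_tmul, form_tmul, ← star_ip, map_star, ContinuousLinearMap.star_eq_adjoint,
        ContinuousLinearMap.adjoint_inner_right, inner_conj_symm]

theorem exists_repr (x : E ⊗[ℂ] L) : ∃ (n : Type (max v w)) (_ : Fintype n) (ξ : n → E) (h : n → L)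
    (c : n → n → Elem M), x = ∑ i, ξ i ⊗ₜ h i ∧
    ∀ (S : L →L[ℂ] L) , (∀ a, π a * S = S * π a) →
     form M E π (∑ i, ξ i ⊗ₜ S (h i)) (∑ i, ξ i ⊗ₜ S (h i)) =
      ((∑ k, ‖S (∑ i, π (c k i) (h i))‖ ^ 2 : ℝ) : ℂ) := by
  obtain ⟨s, rfl⟩ := TensorProduct.exists_finset x
  obtain ⟨c, hc⟩ := gram_factor M (fun i : s => i.1.1)
  refine ⟨s, inferInstance, fun i => i.1.1, fun i => i.1.2, c, (Finset.sum_coe_sort s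
    (fun i => i.1 ⊗ₜ[ℂ] i.2)).symm, fun S hS => ?_⟩
  have hS' : ∀ a k, π a (S k) = S (π a k) := fun a k => congrArg (· k) (hS a)
  simp only [map_sum, LinearMap.sum_apply, form_tmul, hc, map_mul, map_star,
    ContinuousLinearMap.star_eq_adjoint, sum_apply,
    mul_apply_eq_comp, inner_sum, ContinuousLinearMap.adjoint_inner_right, hS',
    Complex.ofReal_sum, Complex.ofReal_pow]
  have : ∀ k, ((‖∑ i, S (π (c k i) i.1.2)‖ : ℂ)) ^ 2 =
      ∑ i, ∑ j, ⟪S (π (c k i) i.1.2), S (π (c k j) j.1.2)⟫_ℂ := fun k => by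
    have := (inner_self_eq_norm_sq_to_K (𝕜 := ℂ) (∑ i, S (π (c k i) i.1.2))).symm
    simp only [sum_inner, inner_sum] at this
    refine this.trans ?_
    exact Finset.sum_comm
  simp only [this]
  rw [Finset.sum_comm]
  refine (Finset.sum_congr rfl fun _ _ => Finset.sum_comm).trans ?_
  exact Finset.sum_comm

theorem form_self_nonneg (x : E ⊗[ℂ] L) : 0 ≤ (form M E π x x).re := by
  obtain ⟨n, _, ξ, h, c, rfl, H⟩ := exists_repr M E π x
  have := H 1 (by simp)
  simp only [one_apply_eq_self] at this
  rw [this, Complex.ofReal_re]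
  positivity

/-- The semi-inner product on `E ⊗ L`. -/
@[reducible] def preCore : PreInnerProductSpace.Core ℂ (E ⊗[ℂ] L) where
  inner x y := form M E π x y
  conj_inner_symm x y := form_symm M E π x y
  re_inner_nonneg x := form_self_nonneg M E π x
  add_left x y z := LinearMap.map_add₂ (form M E π) x y z
  smul_left x y r := LinearMap.map_smulₛₗ₂ (form M E π) r x y

instance : SeminormedAddCommGroup (PreTensor M E π) :=
  @InnerProductSpace.Core.toSeminormedAddCommGroup ℂ (E ⊗[ℂ] L) _ _ _ (preCore M E π)

instance : InnerProductSpace ℂ (PreTensor M E π) :=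
  InnerProductSpace.ofCore (F := E ⊗[ℂ] L) (preCore M E π)

/-- The identity map from `E ⊗ L` to `E ⊗ L` with its semi-inner product. -/
def toPre : E ⊗[ℂ] L ≃ₗ[ℂ] PreTensor M E π where
  toFun x := x
  invFun x := x
  map_add' _ _ := rfl
  map_smul' _ _ := rfl
  left_inv _ := rfl
  right_inv _ := rfl

/-- The Hilbert space `E ⊗_π L`: the Hausdorff completion of `E ⊗ L`. -/
abbrev ITensor : Type (max v w) := UniformSpace.Completion (PreTensor M E π)

theorem pre_inner (x y : E ⊗[ℂ] L) : ⟪toPre M E π x, toPre M E π y⟫_ℂ = form M E π x y := rfl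

theorem pre_norm_sq (x : E ⊗[ℂ] L) : ‖toPre M E π x‖ ^ 2 = (form M E π x x).re := by
  rw [← pre_inner]; exact (inner_self_eq_norm_sq (𝕜 := ℂ) _).symm

variable {M E} in
/-- The operator on `E ⊗_π L` determined by a bounded linear map on `E ⊗ L`. -/
def extendOp (T : E ⊗[ℂ] L →ₗ[ℂ] E ⊗[ℂ] L) (C : ℝ)
    (hT : ∀ x, ‖toPre M E π (T x)‖ ≤ C * ‖toPre M E π x‖) :
    ITensor M E π →L[ℂ] ITensor M E π :=
  (LinearMap.mkContinuous (((toPre M E π).toLinearMap ∘ₗ T) ∘ₗ (toPre M E π).symm.toLinearMap)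
    C hT).completion

end Interior

section Interior2
variable {K : Type u} [NormedAddCommGroup K] [InnerProductSpace ℂ K] [CompleteSpace K]
variable {M : VonNeumannAlgebra K} {E : Type v} [NormedAddCommGroup E] [NormedSpace ℂ E]
  [HilbertModule M E]
  {L : Type w} [NormedAddCommGroup L] [InnerProductSpace ℂ L] [CompleteSpace L]
  {π : Elem M →⋆ₙₐ[ℂ] (L →L[ℂ] L)}
open HilbertModule TensorProduct

theorem norm_tmul_le (ξ : E) (h : L) : ‖toPre M E π (ξ ⊗ₜ[ℂ] h)‖ ≤ ‖ξ‖ * ‖h‖ := by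
  refine le_of_sq_le_sq ?_ (by positivity)
  rw [pre_norm_sq, form_tmul]
  calc (⟪h, π (ip ξ ξ) h⟫_ℂ).re ≤ ‖⟪h, π (ip ξ ξ) h⟫_ℂ‖ := Complex.re_le_norm _
    _ ≤ ‖h‖ * (‖π (ip ξ ξ)‖ * ‖h‖) := (norm_inner_le_norm _ _).trans
        (by gcongr; exact ContinuousLinearMap.le_opNorm _ _)
    _ ≤ ‖h‖ * (‖ip (M := M) ξ ξ‖ * ‖h‖) := by
        gcongr; exact NonUnitalStarAlgHom.norm_apply_le π _
    _ = (‖ξ‖ * ‖h‖) ^ 2 := by rw [← norm_sq_eq (M := M) ξ]; ring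

variable (π) in
/-- The operator `L_ξ : L → E ⊗_π L`, `h ↦ ξ ⊗ h`. -/
def tensorLeft (ξ : E) : L →L[ℂ] ITensor M E π :=
  UniformSpace.Completion.toComplL.comp
    (LinearMap.mkContinuous ((toPre M E π).toLinearMap ∘ₗ mk ℂ E L ξ) ‖ξ‖ (norm_tmul_le ξ))

theorem tensorLeft_apply (ξ : E) (h : L) :
    tensorLeft π ξ h = ((toPre M E π (ξ ⊗ₜ h) : PreTensor M E π) : ITensor M E π) := rfl

theorem inner_tensorLeft (ξ ζ : E) (h k : L) :
    ⟪tensorLeft π ξ h, tensorLeft π ζ k⟫_ℂ = ⟪h, π (ip ξ ζ) k⟫_ℂ := by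
  rw [tensorLeft_apply, tensorLeft_apply, UniformSpace.Completion.inner_coe, pre_inner, form_tmul]

theorem ITensor.induction {p : ITensor M E π → Prop} (hp : IsClosed {x | p x})
    (h0 : p 0) (hadd : ∀ x y, p x → p y → p (x + y)) (ht : ∀ ξ h, p (tensorLeft π ξ h)) (x) :
    p x := by
  refine UniformSpace.Completion.induction_on x hp fun y => ?_
  obtain ⟨y, rfl⟩ := (toPre M E π).surjective y
  induction y with
  | zero => rw [map_zero]; exact h0
  | tmul ξ h => exact ht ξ h
  | add x y hx hy => rw [map_add, UniformSpace.Completion.coe_add]; exact hadd _ _ hx hy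

theorem ITensor.clm_ext {G : Type*} [NormedAddCommGroup G] [NormedSpace ℂ G]
    {S T : ITensor M E π →L[ℂ] G}
    (h : ∀ ξ k, S (tensorLeft π ξ k) = T (tensorLeft π ξ k)) : S = T := by
  ext x
  refine ITensor.induction (p := fun x => S x = T x) ?_ (by simp) ?_ h x
  · exact isClosed_eq S.continuous T.continuous
  · intro x y hx hy; rw [map_add, map_add, hx, hy]

theorem extendOp_tensorLeft (T : E ⊗[ℂ] L →ₗ[ℂ] E ⊗[ℂ] L) (C : ℝ)
    (hT : ∀ x, ‖toPre M E π (T x)‖ ≤ C * ‖toPre M E π x‖) (ξ : E) (h : L) :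
    extendOp π T C hT (tensorLeft π ξ h) =
      ((toPre M E π (T (ξ ⊗ₜ h)) : PreTensor M E π) : ITensor M E π) :=
  ContinuousLinearMap.completion_apply_coe _ _

theorem norm_amplify_le (S : L →L[ℂ] L) (hS : ∀ a, π a * S = S * π a) (x : E ⊗[ℂ] L) :
    ‖toPre M E π (S.toLinearMap.lTensor E x)‖ ≤ ‖S‖ * ‖toPre M E π x‖ := by
  refine le_of_sq_le_sq ?_ (by positivity)
  rw [mul_pow, pre_norm_sq, pre_norm_sq]
  obtain ⟨n, _, ξ, h, c, rfl, H⟩ := exists_repr M E π x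
  have h1 := H 1 (by simp)
  simp only [one_apply_eq_self] at h1
  have h2 : S.toLinearMap.lTensor E (∑ i, ξ i ⊗ₜ h i) = ∑ i, ξ i ⊗ₜ S (h i) := by
    simp [map_sum]
  rw [h1, h2, H S hS, Complex.ofReal_re, Complex.ofReal_re, Finset.mul_sum]
  refine Finset.sum_le_sum fun k _ => ?_
  rw [← mul_pow]
  gcongr
  exact S.le_opNorm _

variable (E) in
/-- The operator `I ⊗ S` on `E ⊗_π L`, for `S` in the commutant of `π(M)`. -/
def amplify (S : L →L[ℂ] L) (hS : ∀ a, π a * S = S * π a) : ITensor M E π →L[ℂ] ITensor M E π :=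
  extendOp π (S.toLinearMap.lTensor E) ‖S‖ (norm_amplify_le S hS)

@[simp]
theorem amplify_tensorLeft (S : L →L[ℂ] L) (hS : ∀ a, π a * S = S * π a) (ξ : E) (h : L) :
    amplify E S hS (tensorLeft π ξ h) = tensorLeft π ξ (S h) :=
  extendOp_tensorLeft _ _ _ _ _

end Interior2

section Induced
variable {K : Type u} [NormedAddCommGroup K] [InnerProductSpace ℂ K] [CompleteSpace K]
variable {M : VonNeumannAlgebra K} {E : Type v} [NormedAddCommGroup E] [NormedSpace ℂ E]
  [CompleteSpace E] [WStarCorrespondence M E]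
  {L : Type w} [NormedAddCommGroup L] [InnerProductSpace ℂ L] [CompleteSpace L]
  {π : Elem M →⋆ₙₐ[ℂ] (L →L[ℂ] L)}
open HilbertModule TensorProduct WStarCorrespondence

/-- The left action `φ(a)` as an operator on `E`. -/
def leftAct (a : Elem M) : E →L[ℂ] E := (lact a : Adjointable M E)

theorem ip_leftAct (a : Elem M) (x y : E) :
    (ip (leftAct (star a) x) y : Elem M) = ip x (leftAct a y) := lact_star a x y

theorem leftAct_mul (a b : Elem M) : leftAct (E := E) (a * b) = leftAct a * leftAct b := by
  simp [leftAct]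

theorem leftAct_add (a b : Elem M) : leftAct (E := E) (a + b) = leftAct a + leftAct b := by
  simp [leftAct]

theorem leftAct_smul (c : ℂ) (a : Elem M) : leftAct (E := E) (c • a) = c • leftAct a := by
  simp [leftAct]

theorem form_leftAct (a : Elem M) (x y : E ⊗[ℂ] L) :
    form M E π ((leftAct (star a) : E →L[ℂ] E).toLinearMap.rTensor L x) y =
      form M E π x ((leftAct a : E →L[ℂ] E).toLinearMap.rTensor L y) := by
  induction x with
  | zero => simp
  | add x₁ x₂ h₁ h₂ => simp only [map_add, LinearMap.add_apply, h₁, h₂]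
  | tmul ξ h =>
    induction y with
    | zero => simp
    | add y₁ y₂ h₁ h₂ => simp only [map_add, h₁, h₂]
    | tmul ζ k =>
      simp only [LinearMap.rTensor_tmul, form_tmul, ContinuousLinearMap.coe_coe, ip_leftAct]

theorem form_leftAct_self (a : Elem M) (x : E ⊗[ℂ] L) :
    form M E π ((leftAct a : E →L[ℂ] E).toLinearMap.rTensor L x)
      ((leftAct a : E →L[ℂ] E).toLinearMap.rTensor L x) =
      form M E π x ((leftAct (star a * a) : E →L[ℂ] E).toLinearMap.rTensor L x) := by
  have := form_leftAct (π := π) (star a) x ((leftAct a : E →L[ℂ] E).toLinearMap.rTensor L x)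
  rw [star_star] at this
  rw [this, leftAct_mul]
  congr 1
  exact (LinearMap.rTensor_comp_apply L _ _ x).symm

theorem form_rTensor_mono (p q : Elem M) (c : Elem M) (h : q - p = star c * c) (x : E ⊗[ℂ] L) :
    (form M E π x ((leftAct p : E →L[ℂ] E).toLinearMap.rTensor L x)).re ≤
      (form M E π x ((leftAct q : E →L[ℂ] E).toLinearMap.rTensor L x)).re := by
  have h1 : q = p + star c * c := by rw [← h]; abel
  have h2 : (leftAct q : E →L[ℂ] E).toLinearMap.rTensor L x =
      (leftAct p : E →L[ℂ] E).toLinearMap.rTensor L x +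
      (leftAct (star c * c) : E →L[ℂ] E).toLinearMap.rTensor L x := by
    rw [h1, leftAct_add, ContinuousLinearMap.toLinearMap_add, LinearMap.rTensor_add,
      LinearMap.add_apply]
  rw [h2, map_add, ← form_leftAct_self, Complex.add_re]
  linarith [form_self_nonneg M E π ((leftAct c : E →L[ℂ] E).toLinearMap.rTensor L x)]

theorem norm_leftAct_le (a : Elem M) (x : E ⊗[ℂ] L) :
    ‖toPre M E π ((leftAct a : E →L[ℂ] E).toLinearMap.rTensor L x)‖ ≤
      ‖a‖ * ‖toPre M E π x‖ := by
  refine le_of_sq_le_sq ?_ (by positivity)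
  rw [mul_pow, pre_norm_sq, pre_norm_sq, form_leftAct_self]
  have h1 : 0 ≤ algebraMap ℝ (Elem M) (‖a‖ ^ 2) - star a * a :=
    sub_nonneg.2 CStarAlgebra.star_mul_le_algebraMap_norm_sq
  obtain ⟨c, hc⟩ := CStarAlgebra.nonneg_iff_eq_star_mul_self.1 h1
  refine (form_rTensor_mono _ _ c hc x).trans ?_
  have h3 : algebraMap ℝ (Elem M) (‖a‖ ^ 2) = (((‖a‖ ^ 2 : ℝ) : ℂ)) • (1 : Elem M) := by
    rw [Algebra.algebraMap_eq_smul_one]; exact (Complex.coe_smul _ _).symm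
  rw [h3, leftAct_smul, ContinuousLinearMap.toLinearMap_smul, LinearMap.rTensor_smul,
    LinearMap.smul_apply, map_smul, smul_eq_mul, Complex.re_ofReal_mul]
  refine mul_le_mul_of_nonneg_left ?_ (by positivity)
  set y := (leftAct (1 : Elem M) : E →L[ℂ] E).toLinearMap.rTensor L x with hy
  have h4 : form M E π x y = form M E π y y := by
    rw [hy, form_leftAct_self]; simp
  have h5 : form M E π y x = form M E π y y := by
    rw [← form_symm, h4, form_symm]
  have h6 := form_self_nonneg M E π (x - y)
  simp only [map_sub, LinearMap.sub_apply, h4, h5, Complex.sub_re, sub_self, sub_zero, sub_nonneg] at h6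
  rw [h4]
  exact h6

variable (E π) in
/-- The operator `φ(a) ⊗ I` on `E ⊗_π L`. -/
def inducedOp (a : Elem M) : ITensor M E π →L[ℂ] ITensor M E π :=
  extendOp π ((leftAct a : E →L[ℂ] E).toLinearMap.rTensor L) ‖a‖ (norm_leftAct_le a)

@[simp]
theorem inducedOp_tensorLeft (a : Elem M) (ξ : E) (h : L) :
    inducedOp E π a (tensorLeft π ξ h) = tensorLeft π (leftAct a ξ) h :=
  extendOp_tensorLeft _ _ _ _ _

theorem tensorLeft_add (ξ ζ : E) (h : L) :
    tensorLeft π (ξ + ζ) h = tensorLeft π ξ h + tensorLeft π ζ h := by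
  rw [tensorLeft_apply, add_tmul, map_add, UniformSpace.Completion.coe_add]; rfl

theorem tensorLeft_smul (c : ℂ) (ξ : E) (h : L) :
    tensorLeft π (c • ξ) h = c • tensorLeft π ξ h := by
  rw [tensorLeft_apply, ← smul_tmul', map_smul, UniformSpace.Completion.coe_smul]; rfl

variable (E π) in
/-- The induced representation `a ↦ φ(a) ⊗ I` of `M` on `E ⊗_π L`. -/
def inducedRep : Elem M →⋆ₙₐ[ℂ] (ITensor M E π →L[ℂ] ITensor M E π) where
  toFun := inducedOp E π
  map_smul' c a := ITensor.clm_ext fun ξ k => by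
    simp [leftAct_smul, tensorLeft_smul]
  map_zero' := ITensor.clm_ext fun ξ k => by
    have : leftAct (M := M) (E := E) 0 = 0 := by simp [leftAct]
    simp only [inducedOp_tensorLeft, this, zero_apply]
    simpa using tensorLeft_smul (π := π) 0 ξ k
  map_add' a b := ITensor.clm_ext fun ξ k => by
    simp [leftAct_add, tensorLeft_add]
  map_mul' a b := ITensor.clm_ext fun ξ k => by
    simp [leftAct_mul]
  map_star' a := by
    rw [ContinuousLinearMap.star_eq_adjoint, ContinuousLinearMap.eq_adjoint_iff]
    intro x y
    refine ITensor.induction (p := fun x => ⟪inducedOp E π (star a) x, y⟫_ℂ =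
      ⟪x, inducedOp E π a y⟫_ℂ) (isClosed_eq (by fun_prop) (by fun_prop)) (by simp)
      (fun x x' h h' => by simp only [map_add, inner_add_left, h, h']) (fun ξ h => ?_) x
    refine ITensor.induction (p := fun y => ⟪inducedOp E π (star a) (tensorLeft π ξ h), y⟫_ℂ =
      ⟪tensorLeft π ξ h, inducedOp E π a y⟫_ℂ) (isClosed_eq (by fun_prop) (by fun_prop)) (by simp)
      (fun x x' h h' => by simp only [map_add, inner_add_right, h, h']) (fun ζ k => ?_) y
    simp only [inducedOp_tensorLeft, inner_tensorLeft, ip_leftAct]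

@[simp]
theorem inducedRep_tensorLeft (a : Elem M) (ξ : E) (h : L) :
    inducedRep E π a (tensorLeft π ξ h) = tensorLeft π (leftAct a ξ) h :=
  extendOp_tensorLeft _ _ _ _ _

theorem adjoint_tensorLeft_comp (ξ ζ : E) :
    (ContinuousLinearMap.adjoint (tensorLeft π ξ)).comp (tensorLeft π ζ) = π (ip ξ ζ) := by
  ext h
  refine ext_inner_left ℂ fun k => ?_
  rw [ContinuousLinearMap.comp_apply, ContinuousLinearMap.adjoint_inner_right, inner_tensorLeft]

end Induced

section Fock
variable {K : Type u} [NormedAddCommGroup K] [InnerProductSpace ℂ K] [CompleteSpace K]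

/-- A Hilbert space with a representation of `M`. -/
structure HilbertRep (M : VonNeumannAlgebra K) where
  carrier : Type u
  [normed : NormedAddCommGroup carrier]
  [inner : InnerProductSpace ℂ carrier]
  [complete : CompleteSpace carrier]
  rep : Elem M →⋆ₙₐ[ℂ] (carrier →L[ℂ] carrier)

attribute [instance] HilbertRep.normed HilbertRep.inner HilbertRep.complete

variable (M : VonNeumannAlgebra K) (E : Type u) [NormedAddCommGroup E] [NormedSpace ℂ E]
  [CompleteSpace E] [WStarCorrespondence M E]
open HilbertModule WStarCorrespondence

/-- The identity representation of `M ⊆ B(K)` on `K`. -/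
def idRep : Elem M →⋆ₙₐ[ℂ] (K →L[ℂ] K) :=
  (M.toStarSubalgebra.subtype : Elem M →⋆ₐ[ℂ] (K →L[ℂ] K))

/-- The Hilbert spaces `E^{⊗n} ⊗ K = E ⊗ (E ⊗ ⋯ ⊗ (E ⊗ K))` with the left action
`a ↦ φ⁽ⁿ⁾(a) ⊗ I` of `M`. -/
def level : ℕ → HilbertRep M
  | 0 => ⟨K, idRep M⟩
  | n + 1 => ⟨ITensor M E (level n).rep, inducedRep E (level n).rep⟩

/-- The Hilbert space `E^{⊗n} ⊗ K`. -/
abbrev Level (n : ℕ) : Type u := (level M E n).carrier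

/-- The Hilbert space `⨁ₙ E^{⊗n} ⊗ K`. -/
def FockSpace : Type u := lp (Level M E) 2

instance : NormedAddCommGroup (FockSpace M E) :=
  inferInstanceAs (NormedAddCommGroup (lp (Level M E) 2))

instance : InnerProductSpace ℂ (FockSpace M E) :=
  inferInstanceAs (InnerProductSpace ℂ (lp (Level M E) 2))

instance : CompleteSpace (FockSpace M E) := inferInstanceAs (CompleteSpace (lp (Level M E) 2))

/-- The `n`-th coordinate of an element of `⨁ₙ E^{⊗n} ⊗ K`. -/
instance : CoeFun (FockSpace M E) fun _ => ∀ n, Level M E n :=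
  ⟨fun f => (show lp (Level M E) 2 from f).1⟩

variable {E}

variable {M} in
@[ext]
theorem FockSpace.ext {f g : FockSpace M E} (h : ∀ n, f n = g n) : f = g := lp.ext (funext h)

theorem fock_add_apply (f g : FockSpace M E) (n : ℕ) : (f + g) n = f n + g n := rfl

theorem fock_smul_apply (c : ℂ) (f : FockSpace M E) (n : ℕ) : (c • f) n = c • f n := rfl

theorem fock_hasSum_norm (f : FockSpace M E) : HasSum (fun n => ‖f n‖ ^ 2) (‖f‖ ^ 2) := by
  have h := lp.hasSum_norm (p := 2) (by norm_num) (show lp (Level M E) 2 from f)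
  simp only [ENNReal.toReal_ofNat, Real.rpow_ofNat] at h
  exact h

theorem fock_hasSum_inner (f g : FockSpace M E) : HasSum (fun n => ⟪f n, g n⟫_ℂ) ⟪f, g⟫_ℂ :=
  lp.hasSum_inner (𝕜 := ℂ) (show lp (Level M E) 2 from f) g

/-- The creation operator `h ↦ ξ ⊗ h` from `E^{⊗n} ⊗ K` to `E^{⊗(n+1)} ⊗ K`. -/
def levelLeft (ξ : E) (n : ℕ) : Level M E n →L[ℂ] Level M E (n + 1) :=
  tensorLeft (level M E n).rep ξ

theorem norm_levelLeft (ξ : E) (n : ℕ) : ‖levelLeft M ξ n‖ ≤ ‖ξ‖ := by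
  refine ContinuousLinearMap.opNorm_le_bound _ (norm_nonneg _) fun h => ?_
  show ‖tensorLeft (level M E n).rep ξ h‖ ≤ _
  rw [tensorLeft_apply, UniformSpace.Completion.norm_coe]
  exact norm_tmul_le ξ h

/-- The sequence `(0, ξ ⊗ f₀, ξ ⊗ f₁, …)`. -/
def shiftSeq (ξ : E) (f : ∀ n, Level M E n) : ∀ n, Level M E n
  | 0 => 0
  | n + 1 => levelLeft M ξ n (f n)

theorem hasSum_shiftSeq (ξ : E) (f : FockSpace M E) :
    Summable (fun n => ‖shiftSeq M ξ f n‖ ^ 2) ∧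
      ∑' n, ‖shiftSeq M ξ f n‖ ^ 2 ≤ (‖ξ‖ * ‖f‖) ^ 2 := by
  have hf := fock_hasSum_norm M f
  have hle : ∀ n, ‖shiftSeq M ξ f (n + 1)‖ ^ 2 ≤ ‖ξ‖ ^ 2 * ‖f n‖ ^ 2 := fun n => by
    rw [← mul_pow]
    gcongr
    exact (levelLeft M ξ n).le_of_opNorm_le (norm_levelLeft M ξ n) _
  have hs : Summable (fun n => ‖shiftSeq M ξ f (n + 1)‖ ^ 2) :=
    Summable.of_nonneg_of_le (fun _ => by positivity) hle (hf.summable.mul_left _)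
  have hs' : Summable (fun n => ‖shiftSeq M ξ f n‖ ^ 2) :=
    (summable_nat_add_iff (f := fun n => ‖shiftSeq M ξ f n‖ ^ 2) 1).1 hs
  refine ⟨hs', ?_⟩
  rw [hs'.tsum_eq_zero_add, mul_pow, ← hf.tsum_eq, ← tsum_mul_left]
  simp only [shiftSeq, norm_zero, ne_eq, OfNat.ofNat_ne_zero, not_false_eq_true, zero_pow, zero_add]
  exact hs.tsum_le_tsum hle (hf.summable.mul_left _)

/-- The vector `(0, ξ ⊗ f₀, ξ ⊗ f₁, …)`. -/
def shiftVec (ξ : E) (f : FockSpace M E) : FockSpace M E :=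
  (⟨shiftSeq M ξ f, memℓp_gen (by simpa using (hasSum_shiftSeq M ξ f).1)⟩ : lp (Level M E) 2)

/-- The operator `T_ξ ⊗ I` on `⨁ₙ E^{⊗n} ⊗ K`: it maps `(f₀, f₁, …)` to
`(0, ξ ⊗ f₀, ξ ⊗ f₁, …)`. -/
def shift (ξ : E) : FockSpace M E →L[ℂ] FockSpace M E :=
  LinearMap.mkContinuous
    { toFun := shiftVec M ξ
      map_add' f g := by
        ext n
        cases n with
        | zero => exact (add_zero _).symm
        | succ n => exact map_add (levelLeft M ξ n) (f n) (g n)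
      map_smul' c f := by
        ext n
        cases n with
        | zero => exact (smul_zero _).symm
        | succ n => exact map_smul (levelLeft M ξ n) c (f n) } ‖ξ‖ (by
    intro f
    refine le_of_sq_le_sq ?_ (by positivity)
    refine le_trans (le_of_eq ?_) (hasSum_shiftSeq M ξ f).2
    exact (fock_hasSum_norm M (shiftVec M ξ f)).tsum_eq.symm)

variable (E)

/-- The operator `φ_∞(a) ⊗ I = diag(a, φ(a) ⊗ I, φ⁽²⁾(a) ⊗ I, …)` on `⨁ₙ E^{⊗n} ⊗ K`. -/
def diag (a : Elem M) : FockSpace M E →L[ℂ] FockSpace M E :=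
  (lp.mapCLM 2 (fun n => (level M E n).rep a) (K := ‖a‖) (norm_nonneg _)
    fun _ => NonUnitalStarAlgHom.norm_apply_le _ a : lp (Level M E) 2 →L[ℂ] lp (Level M E) 2)

/-- The embedding of `K = M ⊗ K` as the zeroth summand of `⨁ₙ E^{⊗n} ⊗ K`. -/
def vacuum : K →L[ℂ] FockSpace M E :=
  (lp.singleContinuousLinearMap ℂ (Level M E) 2 0 : Level M E 0 →L[ℂ] lp (Level M E) 2)

variable {E}

@[simp]
theorem shift_zero (ξ : E) (f : FockSpace M E) : shift M ξ f 0 = 0 := rfl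

@[simp]
theorem shift_succ (ξ : E) (f : FockSpace M E) (n : ℕ) :
    shift M ξ f (n + 1) = levelLeft M ξ n (f n) := rfl

@[simp]
theorem diag_apply (a : Elem M) (f : FockSpace M E) (n : ℕ) :
    diag M E a f n = (level M E n).rep a (f n) := rfl

@[simp]
theorem vacuum_zero (k : K) : vacuum M E k 0 = k := rfl

@[simp]
theorem vacuum_succ (k : K) (n : ℕ) : vacuum M E k (n + 1) = 0 := rfl

theorem rep_levelLeft (a : Elem M) (ξ : E) (n : ℕ) (h : Level M E n) :
    (level M E (n + 1)).rep a (levelLeft M ξ n h) = levelLeft M (leftAct a ξ) n h :=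
  inducedRep_tensorLeft a ξ h

theorem inner_levelLeft (ξ ζ : E) (n : ℕ) (h k : Level M E n) :
    ⟪levelLeft M ξ n h, levelLeft M ζ n k⟫_ℂ = ⟪h, (level M E n).rep (ip ξ ζ) k⟫_ℂ :=
  inner_tensorLeft ξ ζ h k

theorem diag_shift (a : Elem M) (ξ : E) :
    diag M E a ∘L shift M ξ = shift M (leftAct a ξ) := by
  ext f n
  cases n with
  | zero => simp
  | succ n => simp [rep_levelLeft]

theorem diag_vacuum (a : Elem M) : diag M E a ∘L vacuum M E = vacuum M E ∘L (a : K →L[ℂ] K) := by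
  ext f n
  cases n with
  | zero => rfl
  | succ n => simp

theorem adjoint_diag (a : Elem M) :
    ContinuousLinearMap.adjoint (diag M E a) = diag M E (star a) := by
  symm
  rw [ContinuousLinearMap.eq_adjoint_iff]
  intro f g
  rw [← (fock_hasSum_inner M _ _).tsum_eq, ← (fock_hasSum_inner M _ _).tsum_eq]
  refine tsum_congr fun n => ?_
  rw [diag_apply, diag_apply, map_star, ContinuousLinearMap.star_eq_adjoint,
    ContinuousLinearMap.adjoint_inner_left]

theorem adjoint_shift_shift (ξ ζ : E) :
    ContinuousLinearMap.adjoint (shift M ξ) ∘L shift M ζ = diag M E (ip ξ ζ) := by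
  ext1 f
  refine ext_inner_left ℂ fun g => ?_
  rw [ContinuousLinearMap.comp_apply, ContinuousLinearMap.adjoint_inner_right,
    ← (fock_hasSum_inner M _ _).tsum_eq, ← (fock_hasSum_inner M _ _).tsum_eq,
    (fock_hasSum_inner M (shift M ξ g) (shift M ζ f)).summable.tsum_eq_zero_add]
  simp [inner_levelLeft]

theorem adjoint_shift_vacuum (ξ : E) :
    ContinuousLinearMap.adjoint (shift M ξ) ∘L vacuum M E = 0 := by
  ext1 k
  refine ext_inner_left ℂ fun g => ?_
  rw [ContinuousLinearMap.comp_apply, ContinuousLinearMap.adjoint_inner_right,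
    ← (fock_hasSum_inner M _ _).tsum_eq]
  rw [zero_apply, inner_zero_right]
  refine (tsum_congr fun n => ?_).trans tsum_zero
  cases n with
  | zero => exact inner_zero_left (E := K) k
  | succ n => simp

theorem adjoint_vacuum_vacuum :
    ContinuousLinearMap.adjoint (vacuum M E) ∘L vacuum M E = 1 := by
  ext1 k
  refine ext_inner_left ℂ fun g => ?_
  rw [ContinuousLinearMap.comp_apply, ContinuousLinearMap.adjoint_inner_right,
    ← (fock_hasSum_inner M _ _).tsum_eq, tsum_eq_single 0]
  · rfl
  · intro n hn
    obtain ⟨n, rfl⟩ := Nat.exists_eq_succ_of_ne_zero hn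
    simp

/-- The elementary tensor `ξ₁ ⊗ ⋯ ⊗ ξₙ ⊗ b ∈ E^{⊗n} ⊗ M = E^{⊗n}`, as the operator
`k ↦ ξ₁ ⊗ ⋯ ⊗ ξₙ ⊗ b k` from `K` to `⨁ₙ E^{⊗n} ⊗ K`. -/
def elemTensor : List E → Elem M → (K →L[ℂ] FockSpace M E)
  | [], b => vacuum M E ∘L (b : K →L[ℂ] K)
  | ξ :: l, b => shift M ξ ∘L elemTensor l b

theorem elemTensor_rsmul (l : List E) (b a : Elem M) :
    elemTensor M l b ∘L (a : K →L[ℂ] K) = elemTensor M l (b * a) := by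
  induction l with
  | nil => rfl
  | cons ξ l ih => rw [elemTensor, elemTensor, ContinuousLinearMap.comp_assoc, ih]

theorem exists_diag_elemTensor (a : Elem M) (l : List E) (b : Elem M) :
    ∃ l' b', l'.length = l.length ∧ diag M E a ∘L elemTensor M l b = elemTensor M l' b' := by
  cases l with
  | nil => exact ⟨[], a * b, rfl, by
      rw [elemTensor, ← ContinuousLinearMap.comp_assoc, diag_vacuum]; rfl⟩
  | cons ξ l => exact ⟨leftAct a ξ :: l, b, rfl, by
      rw [elemTensor, ← ContinuousLinearMap.comp_assoc, diag_shift]; rfl⟩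

theorem adjoint_elemTensor_mem (l l' : List E) (b b' : Elem M) :
    ContinuousLinearMap.adjoint (elemTensor M l b) ∘L elemTensor M l' b' ∈
      M.toStarSubalgebra := by
  induction l generalizing l' b' with
  | nil =>
    cases l' with
    | nil =>
      have : ContinuousLinearMap.adjoint (elemTensor M ([] : List E) b) ∘L
          elemTensor M ([] : List E) b' = ((star b * b' : Elem M) : K →L[ℂ] K) := by
        rw [elemTensor, elemTensor, ContinuousLinearMap.adjoint_comp,
          ContinuousLinearMap.comp_assoc, ← ContinuousLinearMap.comp_assoc _ (vacuum M E),
          adjoint_vacuum_vacuum]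
        rfl
      rw [this]; exact (star b * b').2
    | cons ξ l' =>
      have : ContinuousLinearMap.adjoint (vacuum M E) ∘L shift M ξ = 0 := by
        have h := congrArg ContinuousLinearMap.adjoint (adjoint_shift_vacuum M ξ)
        rwa [ContinuousLinearMap.adjoint_comp, ContinuousLinearMap.adjoint_adjoint, map_zero] at h
      rw [elemTensor, elemTensor, ContinuousLinearMap.adjoint_comp,
          ContinuousLinearMap.comp_assoc, ← ContinuousLinearMap.comp_assoc _ (shift M ξ), this,
          ContinuousLinearMap.zero_comp, ContinuousLinearMap.comp_zero]
      exact zero_mem _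
  | cons ζ l ih =>
    cases l' with
    | nil =>
      rw [elemTensor, elemTensor, ContinuousLinearMap.adjoint_comp,
          ContinuousLinearMap.comp_assoc, ← ContinuousLinearMap.comp_assoc _ (vacuum M E),
          adjoint_shift_vacuum, ContinuousLinearMap.zero_comp, ContinuousLinearMap.comp_zero]
      exact zero_mem _
    | cons ξ l' =>
      rw [elemTensor, elemTensor, ContinuousLinearMap.adjoint_comp,
          ContinuousLinearMap.comp_assoc, ← ContinuousLinearMap.comp_assoc _ (shift M ξ),
          adjoint_shift_shift]
      obtain ⟨l₁, b₁, -, h⟩ := exists_diag_elemTensor M (ip ζ ξ) l' b'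
      rw [h]
      exact ih l₁ b₁

variable (E)

/-- The algebraic Fock module: the linear span of the elementary tensors. -/
def algFock : Submodule ℂ (K →L[ℂ] FockSpace M E) :=
  Submodule.span ℂ {x | ∃ l b, x = elemTensor M l b}

/-- The Fock module `𝓕(E) = M ⊕ E ⊕ E^{⊗2} ⊕ ⋯` as a Hilbert `W⋆`-module. It is the self-dual
completion of the algebraic Fock module, obtained by taking the closure in the
strong operator topology (that is, pointwise on `K`) of the elementary tensors, regarded as
operators from `K` to `⨁ₙ E^{⊗n} ⊗ K`. -/
def fock : Submodule ℂ (K →L[ℂ] FockSpace M E) :=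
  (((algFock M E).map
    (LinearMap.ltoFun ℂ K (FockSpace M E) ℂ ∘ₗ
      ContinuousLinearMap.coeLM ℂ)).topologicalClosure).comap
    (LinearMap.ltoFun ℂ K (FockSpace M E) ℂ ∘ₗ ContinuousLinearMap.coeLM ℂ)

theorem mem_fock {x : K →L[ℂ] FockSpace M E} :
    x ∈ fock M E ↔ (x : K → FockSpace M E) ∈
      closure ((fun y : K →L[ℂ] FockSpace M E => (y : K → FockSpace M E)) '' algFock M E) :=
  Iff.rfl

theorem algFock_le_fock : algFock M E ≤ fock M E := fun x hx =>
  subset_closure ⟨x, hx, rfl⟩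

variable {M E} in
theorem map_mem_fock {Φ : (K →L[ℂ] FockSpace M E) →ₗ[ℂ] (K →L[ℂ] FockSpace M E)}
    {Ψ : (K → FockSpace M E) → (K → FockSpace M E)} (hΨ : Continuous Ψ)
    (h : ∀ x, (Φ x : K → FockSpace M E) = Ψ x)
    (hΦ : ∀ l b, Φ (elemTensor M l b) ∈ algFock M E) {x : K →L[ℂ] FockSpace M E}
    (hx : x ∈ fock M E) : Φ x ∈ fock M E := by
  have hΦ' : ∀ y ∈ algFock M E, Φ y ∈ algFock M E := fun y hy => by
    have : algFock M E ≤ (algFock M E).comap Φ := by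
      refine Submodule.span_le.2 ?_
      rintro _ ⟨l, b, rfl⟩
      exact hΦ l b
    exact this hy
  rw [mem_fock] at hx ⊢
  rw [h]
  refine map_mem_closure hΨ hx ?_
  rintro _ ⟨y, hy, rfl⟩
  exact ⟨Φ y, hΦ' y hy, h y⟩

variable {M E} in
/-- A closedness principle: a pointwise closed linear condition on elementary tensors holds
on `𝓕(E)`. -/
theorem fock_induction {p : Submodule ℂ (K →L[ℂ] FockSpace M E)} {q : Set (K → FockSpace M E)}
    (hq : IsClosed q) (hpq : ∀ x, x ∈ p ↔ (x : K → FockSpace M E) ∈ q)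
    (h : ∀ l b, elemTensor M l b ∈ p) {x : K →L[ℂ] FockSpace M E} (hx : x ∈ fock M E) : x ∈ p := by
  rw [hpq]
  have : algFock M E ≤ p := by
    refine Submodule.span_le.2 ?_
    rintro _ ⟨l, b, rfl⟩
    exact h l b
  refine (closure_minimal ?_ hq) ((mem_fock M E).1 hx)
  rintro _ ⟨y, hy, rfl⟩
  exact (hpq y).1 (this hy)

end Fock

section FockModule
variable {K : Type u} [NormedAddCommGroup K] [InnerProductSpace ℂ K] [CompleteSpace K]
variable (M : VonNeumannAlgebra K) (E : Type u) [NormedAddCommGroup E] [NormedSpace ℂ E]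
  [CompleteSpace E] [WStarCorrespondence M E]
open HilbertModule WStarCorrespondence

variable {M E}

theorem comp_mem_fock (a : Elem M) {x : K →L[ℂ] FockSpace M E} (hx : x ∈ fock M E) :
    x ∘L (a : K →L[ℂ] K) ∈ fock M E :=
  map_mem_fock (Φ := { toFun y := y ∘L (a : K →L[ℂ] K), map_add' _ _ := rfl,
                       map_smul' _ _ := rfl })
    (Ψ := fun f k => f ((a : K →L[ℂ] K) k)) (by fun_prop) (fun _ => rfl)
    (fun l b => Submodule.subset_span ⟨l, b * a, elemTensor_rsmul M l b a⟩) hx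

theorem shift_comp_mem_fock (ξ : E) {x : K →L[ℂ] FockSpace M E} (hx : x ∈ fock M E) :
    shift M ξ ∘L x ∈ fock M E :=
  map_mem_fock (Φ := { toFun y := shift M ξ ∘L y, map_add' _ _ := by ext1; simp,
                       map_smul' _ _ := by ext1; simp })
    (Ψ := fun f k => shift M ξ (f k)) (by fun_prop) (fun _ => rfl)
    (fun l b => Submodule.subset_span ⟨ξ :: l, b, rfl⟩) hx

theorem diag_comp_mem_fock (a : Elem M) {x : K →L[ℂ] FockSpace M E} (hx : x ∈ fock M E) :
    diag M E a ∘L x ∈ fock M E :=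
  map_mem_fock (Φ := { toFun y := diag M E a ∘L y, map_add' _ _ := by ext1; simp,
                       map_smul' _ _ := by ext1; simp })
    (Ψ := fun f k => diag M E a (f k)) (by fun_prop) (fun _ => rfl)
    (fun l b => by
      obtain ⟨l', b', -, h⟩ := exists_diag_elemTensor M a l b
      exact Submodule.subset_span ⟨l', b', h⟩) hx

theorem adjoint_shift_comp_mem_fock (ξ : E) {x : K →L[ℂ] FockSpace M E} (hx : x ∈ fock M E) :
    ContinuousLinearMap.adjoint (shift M ξ) ∘L x ∈ fock M E :=
  map_mem_fock (Φ := { toFun y := ContinuousLinearMap.adjoint (shift M ξ) ∘L y,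
                       map_add' _ _ := by ext1; simp,
                       map_smul' _ _ := by ext1; simp })
    (Ψ := fun f k => ContinuousLinearMap.adjoint (shift M ξ) (f k)) (by fun_prop) (fun _ => rfl)
    (fun l b => by
      cases l with
      | nil =>
        have : ContinuousLinearMap.adjoint (shift M ξ) ∘L elemTensor M ([] : List E) b = 0 := by
          rw [elemTensor, ← ContinuousLinearMap.comp_assoc, adjoint_shift_vacuum,
            ContinuousLinearMap.zero_comp]
        exact (congrArg (· ∈ algFock M E) this).mpr (zero_mem _)
      | cons ζ l =>
        obtain ⟨l', b', -, h⟩ := exists_diag_elemTensor M (ip ξ ζ) l b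
        refine Submodule.subset_span ⟨l', b', ?_⟩
        rw [← h, ← adjoint_shift_shift, ContinuousLinearMap.comp_assoc]
        rfl) hx

theorem adjoint_comp_mem {x y : K →L[ℂ] FockSpace M E} (hx : x ∈ fock M E) (hy : y ∈ fock M E) :
    ContinuousLinearMap.adjoint x ∘L y ∈ M.toStarSubalgebra := by
  have key : ∀ {x : K →L[ℂ] FockSpace M E}, (∀ l b, ContinuousLinearMap.adjoint x ∘L
      elemTensor M l b ∈ M.toStarSubalgebra) → ∀ {y}, y ∈ fock M E →
      ContinuousLinearMap.adjoint x ∘L y ∈ M.toStarSubalgebra := by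
    intro x hx y hy
    refine fock_induction (p := M.toStarSubalgebra.toSubalgebra.toSubmodule.comap
      (({ toFun y := ContinuousLinearMap.adjoint x ∘L y, map_add' _ _ := by ext1; simp,
          map_smul' _ _ := by ext1; simp } : (K →L[ℂ] FockSpace M E) →ₗ[ℂ] (K →L[ℂ] K))))
      (q := {f | ∀ c ∈ M.commutant, ∀ k, c (ContinuousLinearMap.adjoint x (f k)) =
        ContinuousLinearMap.adjoint x (f (c k))}) ?_ (fun y => ?_) hx hy
    · simp only [Set.ofPred_forall]
      refine isClosed_iInter fun c => isClosed_iInter fun _ => isClosed_iInter fun k =>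
        isClosed_eq (by fun_prop) (by fun_prop)
    · refine (mem_iff M _).trans (forall₂_congr fun c hc => ?_)
      exact ContinuousLinearMap.ext_iff
  refine key (fun l b => ?_) hy
  have := key (fun l' b' => adjoint_elemTensor_mem M l l' b b') hx
  have h2 := star_mem this
  rwa [ContinuousLinearMap.star_eq_adjoint, ContinuousLinearMap.adjoint_comp,
    ContinuousLinearMap.adjoint_adjoint] at h2

theorem isClosed_fock : IsClosed (fock M E : Set (K →L[ℂ] FockSpace M E)) :=
  IsClosed.preimage (f := fun x : K →L[ℂ] FockSpace M E => (x : K → FockSpace M E))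
    (continuous_pi fun k => by fun_prop) isClosed_closure

variable (M E) in
/-- The Fock module `𝓕(E)`, as a type. -/
def Fock : Type u := fock M E

instance : NormedAddCommGroup (Fock M E) := inferInstanceAs (NormedAddCommGroup (fock M E))

instance : NormedSpace ℂ (Fock M E) := inferInstanceAs (NormedSpace ℂ (fock M E))

instance : CompleteSpace (Fock M E) := isClosed_fock.completeSpace_coe

/-- The operator from `K` to `⨁ₙ E^{⊗n} ⊗ K` given by an element of `𝓕(E)`. -/
def Fock.val : Fock M E →L[ℂ] (K →L[ℂ] FockSpace M E) := (fock M E).subtypeL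

theorem Fock.val_mem (x : Fock M E) : x.val ∈ fock M E := x.2

theorem Fock.ext {x y : Fock M E} (h : x.val = y.val) : x = y := Subtype.ext h

/-- The element of `𝓕(E)` given by an operator in its underlying space. -/
def Fock.mk (x : K →L[ℂ] FockSpace M E) (hx : x ∈ fock M E) : Fock M E := ⟨x, hx⟩

@[simp]
theorem Fock.val_mk (x : K →L[ℂ] FockSpace M E) (hx : x ∈ fock M E) : (Fock.mk x hx).val = x := rfl

/-- `𝓕(E)` is a Hilbert module over `M`: the right action of `a` is `x ↦ x ∘ a`, and the inner
product is `⟨x, y⟩ = x⋆ y ∈ M`. -/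
instance : HilbertModule M (Fock M E) where
  rsmul x a := Fock.mk (x.val ∘L (a : K →L[ℂ] K)) (comp_mem_fock a x.val_mem)
  add_rsmul _ _ _ := rfl
  rsmul_add x a b := Fock.ext (by ext1; simp)
  rsmul_mul _ _ _ := rfl
  rsmul_one _ := rfl
  smul_rsmul _ _ _ := rfl
  rsmul_smul z x a := Fock.ext (by ext1; simp)
  ip x y := ⟨ContinuousLinearMap.adjoint x.val ∘L y.val, adjoint_comp_mem x.val_mem y.val_mem⟩
  ip_add_right x y z := Subtype.ext (by ext1; simp)
  ip_smul_right c x y := Subtype.ext (by ext1; simp)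
  ip_rsmul_right _ _ _ := rfl
  star_ip x y := Subtype.ext (by
    show star (ContinuousLinearMap.adjoint x.val ∘L y.val) = _
    rw [ContinuousLinearMap.star_eq_adjoint, ContinuousLinearMap.adjoint_comp,
      ContinuousLinearMap.adjoint_adjoint])
  ip_self_nonneg x := by
    show (0 : K →L[ℂ] K) ≤ ContinuousLinearMap.adjoint x.val ∘L x.val
    rw [ContinuousLinearMap.nonneg_iff_isPositive]
    exact ContinuousLinearMap.isPositive_adjoint_comp_self _
  norm_sq_eq x := by
    rw [sq]
    exact (ContinuousLinearMap.norm_adjoint_comp_self x.val).symm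

/-- Left composition with an operator `S` preserving `𝓕(E)`, as a bounded operator on `𝓕(E)`. -/
def leftComp (S : FockSpace M E →L[ℂ] FockSpace M E) (h : ∀ x ∈ fock M E, S ∘L x ∈ fock M E) :
    Fock M E →L[ℂ] Fock M E :=
  ((ContinuousLinearMap.compL ℂ K (FockSpace M E) (FockSpace M E) S).comp
    (fock M E).subtypeL).codRestrict (fock M E) fun x => h x x.2

@[simp]
theorem leftComp_val (S : FockSpace M E →L[ℂ] FockSpace M E) (h : ∀ x ∈ fock M E, S ∘L x ∈ fock M E)
    (x : Fock M E) : (leftComp S h x).val = S ∘L x.val := rfl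

/-- Left composition with an operator `S` such that `S` and `S⋆` preserve `𝓕(E)`, as an
adjointable operator on `𝓕(E)`. -/
def leftMul (S : FockSpace M E →L[ℂ] FockSpace M E)
    (h : ∀ x ∈ fock M E, S ∘L x ∈ fock M E)
    (h' : ∀ x ∈ fock M E, ContinuousLinearMap.adjoint S ∘L x ∈ fock M E) :
    Adjointable M (Fock M E) :=
  ⟨leftComp S h, leftComp (ContinuousLinearMap.adjoint S) h', fun x y => Subtype.ext (by
      show ContinuousLinearMap.adjoint (ContinuousLinearMap.adjoint S ∘L x.val) ∘L y.val =
        ContinuousLinearMap.adjoint x.val ∘L (S ∘L y.val)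
      rw [ContinuousLinearMap.adjoint_comp, ContinuousLinearMap.adjoint_adjoint]
      rfl)⟩

variable (M) in
/-- The creation operator `T_ξ ∈ 𝓛(𝓕(E))`, `T_ξ η = ξ ⊗ η`. -/
def creation (ξ : E) : Adjointable M (Fock M E) :=
  leftMul (shift M ξ) (fun _ => shift_comp_mem_fock ξ) (fun _ => adjoint_shift_comp_mem_fock ξ)

variable (E) in
/-- The left action `φ_∞(a) = diag(a, φ(a), φ⁽²⁾(a), …)` on `𝓕(E)`. -/
def phiInf (a : Elem M) : Adjointable M (Fock M E) :=
  leftMul (diag M E a) (fun _ => diag_comp_mem_fock a)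
    (fun x hx => by rw [adjoint_diag]; exact diag_comp_mem_fock _ hx)

variable (M E)

/-- The tensor algebra `𝓣₊(E)`: the norm closed subalgebra of `𝓛(𝓕(E))` generated by `φ_∞(M)`
and the creation operators. -/
def tensorAlg : NonUnitalSubalgebra ℂ (Adjointable M (Fock M E)) :=
  (NonUnitalAlgebra.adjoin ℂ
    (Set.range (phiInf (M := M) E) ∪ Set.range (creation M (E := E)))).topologicalClosure

end FockModule

section WeakClosure
variable {A : Type v} [SeminormedAddCommGroup A] [NormedSpace ℂ A] {V : Set (StrongDual ℂ A)}

theorem continuous_weakTopology {X : Type w} {t : TopologicalSpace X} {g : X → A} :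
    Continuous[t, weakTopology V] g ↔
      ∀ f ∈ (Submodule.span ℂ V).topologicalClosure, Continuous[t, inferInstance] fun x => f (g x) := by
  simp only [continuous_iInf_rng, continuous_induced_rng, Subtype.forall]
  rfl

theorem continuous_weakTopology_apply {f : StrongDual ℂ A}
    (hf : f ∈ (Submodule.span ℂ V).topologicalClosure) :
    Continuous[weakTopology V, inferInstance] f :=
  continuous_weakTopology.1 (@continuous_id _ (weakTopology V)) f hf

theorem continuous_weakTopology_map (T : A →L[ℂ] A) (hT : ∀ f ∈ V, f ∘L T ∈ V) :
    Continuous[weakTopology V, weakTopology V] T := by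
  refine continuous_weakTopology.2 fun f hf => ?_
  refine continuous_weakTopology_apply (f := f ∘L T) ?_
  let Φ : StrongDual ℂ A →L[ℂ] StrongDual ℂ A :=
    (ContinuousLinearMap.compL ℂ A A ℂ).flip T
  have h1 : Submodule.span ℂ V ≤ (Submodule.span ℂ V).comap Φ.toLinearMap :=
    Submodule.span_le.2 fun f hf => Submodule.subset_span (hT f hf)
  exact map_mem_closure (f := Φ) Φ.continuous hf h1

theorem closure_op₂ {X : Type w} (t : TopologicalSpace X) {S : Set X} (op : X → X → X)
    (hl : ∀ a, Continuous[t, t] (op a)) (hr : ∀ b, Continuous[t, t] fun a => op a b)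
    (hS : ∀ a ∈ S, ∀ b ∈ S, op a b ∈ S) {a b : X} (ha : a ∈ closure[t] S) (hb : b ∈ closure[t] S) :
    op a b ∈ closure[t] S := by
  have h1 : ∀ b ∈ S, op a b ∈ closure[t] S := fun b hb =>
    map_mem_closure (f := fun a => op a b) (hr b) ha fun a ha => hS a ha b hb
  have := map_mem_closure (hl a) hb h1
  rwa [closure_closure] at this

theorem closure_op₁ {X : Type w} (t : TopologicalSpace X) {S : Set X} (op : X → X)
    (h : Continuous[t, t] op) (hS : ∀ a ∈ S, op a ∈ S) {a : X} (ha : a ∈ closure[t] S) :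
    op a ∈ closure[t] S :=
  map_mem_closure h ha hS

theorem continuous_weakTopology_comp {f : StrongDual ℂ A}
    (hf : f ∈ (Submodule.span ℂ V).topologicalClosure) {g : ℂ → ℂ} (hg : Continuous g) :
    Continuous[weakTopology V, inferInstance] fun a => g (f a) :=
  @Continuous.comp _ _ _ (weakTopology V) _ _ _ _ hg (continuous_weakTopology_apply hf)

end WeakClosure

section HardyAlgebra
variable {K : Type u} [NormedAddCommGroup K] [InnerProductSpace ℂ K] [CompleteSpace K]
variable (M : VonNeumannAlgebra K) (E : Type v) [NormedAddCommGroup E] [NormedSpace ℂ E]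
open HilbertModule WStarCorrespondence

theorem continuous_adj_mul_left [HilbertModule M E] (a : Adjointable M E) :
    Continuous[ultraweakAdj M E, ultraweakAdj M E] (a * ·) := by
  refine continuous_weakTopology_map (ContinuousLinearMap.mul ℂ (Adjointable M E) a) ?_
  rintro f ⟨x, y, h, k, hf⟩
  obtain ⟨S, hS⟩ := a.2
  refine ⟨S x, y, h, k, fun T => ?_⟩
  rw [hS]
  exact hf (a * T)

theorem continuous_adj_mul_right [HilbertModule M E] (a : Adjointable M E) :
    Continuous[ultraweakAdj M E, ultraweakAdj M E] (· * a) := by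
  refine continuous_weakTopology_map ((ContinuousLinearMap.mul ℂ (Adjointable M E)).flip a) ?_
  rintro f ⟨x, y, h, k, hf⟩
  exact ⟨x, (a : E →L[ℂ] E) y, h, k, fun T => hf (T * a)⟩

variable {M E} in
/-- The ultraweak closure of a subalgebra of `𝓛(E)`. -/
def ultraweakClosure [HilbertModule M E] (S : NonUnitalSubalgebra ℂ (Adjointable M E)) :
    NonUnitalSubalgebra ℂ (Adjointable M E) where
  carrier := closure[ultraweakAdj M E] S
  zero_mem' := @subset_closure _ (ultraweakAdj M E) _ _ (zero_mem S)
  add_mem' := closure_op₂ (ultraweakAdj M E) (· + ·)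
    (fun a => continuous_weakTopology.2 fun f hf => by
      simp only [map_add]
      exact continuous_weakTopology_comp hf (continuous_const_add (f a)))
    (fun b => continuous_weakTopology.2 fun f hf => by
      simp only [map_add]
      exact continuous_weakTopology_comp hf (continuous_add_const (f b)))
    (fun a ha b hb => add_mem ha hb)
  smul_mem' c _ := closure_op₁ (ultraweakAdj M E) (c • ·)
    (continuous_weakTopology.2 fun f hf => by
      simp only [map_smul]
      exact continuous_weakTopology_comp hf (continuous_const_smul c))
    (fun x hx => S.smul_mem' c hx)
  mul_mem' := closure_op₂ (ultraweakAdj M E) (· * ·) (continuous_adj_mul_left M E)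
    (continuous_adj_mul_right M E) (fun a ha b hb => mul_mem ha hb)

/-- The Hardy algebra `H^∞(E)`: the ultraweak closure of the tensor algebra in `𝓛(𝓕(E))`. -/
def hardy (E : Type u) [NormedAddCommGroup E] [NormedSpace ℂ E] [CompleteSpace E]
    [WStarCorrespondence M E] : NonUnitalSubalgebra ℂ (Adjointable M (Fock M E)) := ultraweakClosure (tensorAlg M E)

end HardyAlgebra

section Duality
variable {K : Type u} [NormedAddCommGroup K] [InnerProductSpace ℂ K] [CompleteSpace K]
variable {M : VonNeumannAlgebra K}
  {H : Type w} [NormedAddCommGroup H] [InnerProductSpace ℂ H] [CompleteSpace H]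
open HilbertModule WStarCorrespondence

/-- `σ` is a faithful normal (nondegenerate) representation of `M` on `H`. -/
structure IsFaithfulNormal (σ : Elem M →⋆ₙₐ[ℂ] (H →L[ℂ] H)) : Prop where
  map_one : σ 1 = 1
  injective : Function.Injective σ
  normal : Continuous[ultraweakElem M, ultraweak H] σ

/-- The commutant `σ(M)'`. -/
def commutant (σ : Elem M →⋆ₙₐ[ℂ] (H →L[ℂ] H)) : Subalgebra ℂ (H →L[ℂ] H) :=
  Subalgebra.centralizer ℂ (Set.range σ)

theorem commutant_comm {σ : Elem M →⋆ₙₐ[ℂ] (H →L[ℂ] H)} (a : commutant σ) (m : Elem M) :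
    σ m * (a : H →L[ℂ] H) = a * σ m :=
  Subalgebra.mem_centralizer_iff ℂ |>.1 a.2 _ ⟨m, rfl⟩

variable (E : Type v) [NormedAddCommGroup E] [NormedSpace ℂ E] [CompleteSpace E]
  [WStarCorrespondence M E]

/-- The `σ`-dual `E^σ = {η ∈ B(H, E ⊗_σ H) ∣ η σ(a) = (φ(a) ⊗ I) η for all a ∈ M}`. -/
def sigmaDual (σ : Elem M →⋆ₙₐ[ℂ] (H →L[ℂ] H)) : Submodule ℂ (H →L[ℂ] ITensor M E σ) where
  carrier := {η | ∀ a, η ∘L σ a = inducedRep E σ a ∘L η}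
  zero_mem' a := by simp
  add_mem' h h' a := by
    rw [ContinuousLinearMap.add_comp, ContinuousLinearMap.comp_add, h a, h' a]
  smul_mem' c η h a := by
    rw [ContinuousLinearMap.smul_comp, ContinuousLinearMap.comp_smul, h a]

variable {E} {σ : Elem M →⋆ₙₐ[ℂ] (H →L[ℂ] H)}

/-- The left action `a · η = (I ⊗ a) η` of `σ(M)'` on `E^σ`. -/
def dualAct (a : commutant σ) (η : sigmaDual E σ) : sigmaDual E σ :=
  ⟨amplify E (a : H →L[ℂ] H) (commutant_comm a) ∘L (η : H →L[ℂ] ITensor M E σ), fun m => by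
    have : amplify E (a : H →L[ℂ] H) (commutant_comm a) ∘L inducedRep E σ m =
        inducedRep E σ m ∘L amplify E (a : H →L[ℂ] H) (commutant_comm a) :=
      ITensor.clm_ext fun ξ h => by simp
    rw [ContinuousLinearMap.comp_assoc, η.2 m, ← ContinuousLinearMap.comp_assoc, this,
      ContinuousLinearMap.comp_assoc]⟩

/-- The `σ(M)'`-valued inner product `⟨η, ζ⟩ = η⋆ ζ` on `E^σ`. -/
def dualIp (η ζ : sigmaDual E σ) : commutant σ :=
  ⟨ContinuousLinearMap.adjoint (η : H →L[ℂ] ITensor M E σ) ∘L (ζ : H →L[ℂ] ITensor M E σ), by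
    refine (Subalgebra.mem_centralizer_iff ℂ).2 ?_
    rintro _ ⟨m, rfl⟩
    have h := congrArg ContinuousLinearMap.adjoint (η.2 (star m))
    rw [ContinuousLinearMap.adjoint_comp, ContinuousLinearMap.adjoint_comp, map_star σ,
      map_star (inducedRep E σ),
      ContinuousLinearMap.star_eq_adjoint, ContinuousLinearMap.star_eq_adjoint,
      ContinuousLinearMap.adjoint_adjoint, ContinuousLinearMap.adjoint_adjoint] at h
    show σ m ∘L _ = _ ∘L σ m
    rw [← ContinuousLinearMap.comp_assoc, h, ContinuousLinearMap.comp_assoc,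
      ContinuousLinearMap.comp_assoc, ζ.2 m]⟩

/-- The inner product `⟨x₀ ⊗ ⋯ ⊗ xₖ₋₁, b · (y₀ ⊗ ⋯ ⊗ yₖ₋₁)⟩` of elementary tensors in the
`k`-th tensor power `(E^σ)^{⊗k}` of the correspondence `E^σ` over `σ(M)'`, where `b ∈ σ(M)'`. It is
given by `⟨x₀ ⊗ x', b · (y₀ ⊗ y')⟩ = ⟨x', ⟨x₀, b · y₀⟩ · y'⟩`; for `k = 0`, the tensor power is
`σ(M)'` itself and the (empty) elementary tensors are the unit. -/
def tensorIp : ∀ k : ℕ, (Fin k → sigmaDual E σ) → (Fin k → sigmaDual E σ) →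
    commutant σ → commutant σ
  | 0, _, _, b => b
  | k + 1, x, y, b => tensorIp k (Fin.tail x) (Fin.tail y) (dualIp (x 0) (dualAct b (y 0)))

/-- The element `⟨η^{⊗k}, η^{⊗k}⟩` of `σ(M)'`. -/
def powIp (η : sigmaDual E σ) (k : ℕ) : commutant σ := tensorIp k (fun _ => η) (fun _ => η) 1

end Duality

section PointEvaluation
variable {K : Type u} [NormedAddCommGroup K] [InnerProductSpace ℂ K] [CompleteSpace K]
variable (M : VonNeumannAlgebra K) {E : Type u} [NormedAddCommGroup E] [NormedSpace ℂ E]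
  [CompleteSpace E] [WStarCorrespondence M E]
  {H : Type w} [NormedAddCommGroup H] [InnerProductSpace ℂ H] [CompleteSpace H]

theorem tensorAlg_le_hardy : tensorAlg M E ≤ hardy M E := fun _ hx =>
  @subset_closure _ (ultraweakAdj M (Fock M E)) _ _ hx

/-- `T_ξ` as an element of `H^∞(E)`. -/
def hardyCreation (ξ : E) : hardy M E :=
  ⟨creation M ξ, tensorAlg_le_hardy M (NonUnitalSubalgebra.le_topologicalClosure _
    (NonUnitalAlgebra.subset_adjoin ℂ (Or.inr ⟨ξ, rfl⟩)))⟩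

variable (E) in
/-- `φ_∞(a)` as an element of `H^∞(E)`. -/
def hardyPhi (a : Elem M) : hardy M E :=
  ⟨phiInf E a, tensorAlg_le_hardy M (NonUnitalSubalgebra.le_topologicalClosure _
    (NonUnitalAlgebra.subset_adjoin ℂ (Or.inl ⟨a, rfl⟩)))⟩

variable {M}

/-- `ρ` is the representation `σ × T` of `H^∞(E)` on `H` with `T̃ = η⋆`: the ultraweakly continuous
representation with `ρ(T_ξ) = T(ξ) = η⋆ L_ξ` and `ρ(φ_∞(a)) = σ(a)`. -/
structure IsIntegratedForm (σ : Elem M →⋆ₙₐ[ℂ] (H →L[ℂ] H)) (η : sigmaDual E σ)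
    (ρ : hardy M E →ₙₐ[ℂ] (H →L[ℂ] H)) : Prop where
  map_creation : ∀ ξ : E, ρ (hardyCreation M ξ) =
    ContinuousLinearMap.adjoint (η : H →L[ℂ] ITensor M E σ) ∘L tensorLeft σ ξ
  map_phi : ∀ a : Elem M, ρ (hardyPhi M E a) = σ a
  continuous : Continuous[TopologicalSpace.induced Subtype.val (ultraweakAdj M (Fock M E)),
    ultraweak H] ρ

open Classical in
/-- The representation `σ × T` of `H^∞(E)` with `T̃ = η⋆` (which exists if `‖η‖ < 1`). -/
def integratedForm (σ : Elem M →⋆ₙₐ[ℂ] (H →L[ℂ] H)) (η : sigmaDual E σ) :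
    hardy M E →ₙₐ[ℂ] (H →L[ℂ] H) :=
  if h : ∃ ρ, IsIntegratedForm σ η ρ then h.choose else 0

/-- The point evaluation `X(η⋆) = (σ × T)(X)`. -/
def pointEval (σ : Elem M →⋆ₙₐ[ℂ] (H →L[ℂ] H)) (X : hardy M E) (η : sigmaDual E σ) : H →L[ℂ] H :=
  integratedForm σ η X

end PointEvaluation

end Hardy
end

/-! The proof realises every point evaluation as a compression of the induced representation X ↦ X ⊗
I on 𝓕(E) ⊗_σ H, by means of weighted Poisson kernels.

Write Φ(a) = ⟨η, a · η⟩ = η⋆ (I ⊗ a) η. Let a ∈ σ(M)' satisfy Φ(a) ≤ a, and put D = (a − Φ(a))^{1/2}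
∈ σ(M)'. For an operator Q : H → 𝓕(E) ⊗_σ H with (φ_∞(m) ⊗ I) Q = Q σ(m), let C_Q (`creationOp`)
send ξ ⊗ h to (T_ξ ⊗ I) Q h. Since ‖C_Q‖ ≤ ‖Q‖ and ‖η‖ < 1, the equation Q = V D + C_Q η, with V h =
1 ⊗ h the vacuum embedding, has a solution. The range of C_Q is orthogonal to that of V, and C_Q⋆
C_Q = I ⊗ Q⋆Q; hence Q⋆Q − a is fixed by Δ ↦ η⋆ (I ⊗ Δ) η, which has norm at most ‖η‖² < 1, so that
Q⋆Q = a (`exists_kernel`, `gram_eq`). Moreover (T_ξ ⊗ I)⋆ Q = Q L_ξ⋆ η, where L_ξ h = ξ ⊗ h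
(`isKernel_of_eq`).

For a = 1 this gives an isometry P, and ρ_η(X) = P⋆ (X ⊗ I) P. Taking adjoints of the kernel
relations yields Q⋆ (X ⊗ I) = ρ_η(X) Q⋆ on generators, hence on polynomials, hence on H^∞(E) because
matrix coefficients of X ⊗ I are ultraweakly continuous when σ is normal (`IsKernel.adjoint_comp`).
With Q = P this is multiplicativity of ρ_η. Uniqueness is ultraweak density of the polynomials.

For the Schwarz inequality (`pointEval_schwarz`), X(0) = 0 means (X ⊗ I)⋆ V = 0, so Q X(η⋆)⋆ h = (X
⊗ I)⋆ Q h = (X ⊗ I)⋆ C_Q η h. As ‖X ⊗ I‖ ≤ 1, comparing squared norms gives ⟨h, X(η⋆) a X(η⋆)⋆ h⟩ ≤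
‖C_Q η h‖² = ⟨h, Φ(a) h⟩. The second and third assertions are the cases a = Φᵏ(1) and a = 1; these a
satisfy Φ(a) ≤ a because Φ is positive and Φ(1) ≤ 1. -/

noncomputable section
namespace Hardy

/-! ### Weak topologies and their preduals. -/

section WeakTopology
variable {A : Type v} [SeminormedAddCommGroup A] [NormedSpace ℂ A] {V : Set (StrongDual ℂ A)}
  {B : Type w} [SeminormedAddCommGroup B] [NormedSpace ℂ B] {W : Set (StrongDual ℂ B)}

variable (V) in
/-- The closed linear span of `V`: the continuous linear functionals for the weak topology defined
by `V`. -/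
def predual : Submodule ℂ (StrongDual ℂ A) := (Submodule.span ℂ V).topologicalClosure

variable (V) in
theorem isClosed_predual : IsClosed (predual V : Set (StrongDual ℂ A)) :=
  Submodule.isClosed_topologicalClosure _

theorem subset_predual {f : StrongDual ℂ A} (hf : f ∈ V) : f ∈ predual V :=
  Submodule.le_topologicalClosure _ (Submodule.subset_span hf)

/-- A linear functional that is continuous for the weak topology defined by `V` belongs to the
closed linear span of `V`. -/
theorem mem_of_continuous_weakTopology {φ : StrongDual ℂ A}
    (hφ : Continuous[weakTopology V, inferInstance] φ) :
    φ ∈ predual V := by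
  -- A functional continuous for the topology induced by a family lies in its algebraic span. Here
  -- the family is already a closed subspace, so nothing is added.
  have h := (LinearMap.mem_span_iff_continuous
    (f := fun f : (Submodule.span ℂ V).topologicalClosure => (f : StrongDual ℂ A).toLinearMap)
    φ.toLinearMap).2 hφ
  have h2 : Submodule.span ℂ (Set.range fun f : (Submodule.span ℂ V).topologicalClosure =>
      (f : StrongDual ℂ A).toLinearMap) ≤
      (Submodule.span ℂ V).topologicalClosure.map (ContinuousLinearMap.coeLM ℂ) :=
    Submodule.span_le.2 (by rintro _ ⟨f, rfl⟩; exact ⟨f, f.2, rfl⟩)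
  obtain ⟨g, hg, hgφ⟩ := h2 h
  have : g = φ := ContinuousLinearMap.coe_injective hgφ
  exact this ▸ hg

/-- A bounded linear map whose transpose maps `W` to the closed linear span of `V` is continuous
for the weak topologies. -/
theorem continuous_weakTopology_of_comp_mem (T : A →L[ℂ] B)
    (hT : ∀ f ∈ W, f ∘L T ∈ predual V) :
    Continuous[weakTopology V, weakTopology W] T := by
  refine continuous_weakTopology.2 fun f hf => ?_
  refine continuous_weakTopology_apply (f := f ∘L T) ?_
  let Φ : StrongDual ℂ B →L[ℂ] StrongDual ℂ A := (ContinuousLinearMap.compL ℂ A B ℂ).flip T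
  have h1 : Submodule.span ℂ W ≤ (predual V).comap Φ.toLinearMap :=
    Submodule.span_le.2 fun f hf => hT f hf
  -- The transpose of `T` is norm continuous, so it maps the closed span of `W` into that of `V`
  -- once it does so on `W`.
  have h2 := map_mem_closure (f := Φ) (t := (predual V : Set (StrongDual ℂ A)))
    Φ.continuous hf h1
  rwa [IsClosed.closure_eq (isClosed_predual V)] at h2

/-- The weak topology defined by `V` is weaker than the norm topology. -/
theorem le_weakTopology : (inferInstance : TopologicalSpace A) ≤ weakTopology V :=
  continuous_id_iff_le.1 (continuous_weakTopology.2 fun f _ => f.continuous)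

end WeakTopology

/-! ### A norm bound for symmetric operators from the growth of powers. -/

section Symmetric

/-- A symmetric operator whose powers satisfy `‖Tᵐ x‖ ≤ C Dᵐ` satisfies `‖T x‖ ≤ D ‖x‖`. -/
theorem norm_apply_le_of_pow_le {Y : Type v} [SeminormedAddCommGroup Y] [InnerProductSpace ℂ Y]
    (T : Y →ₗ[ℂ] Y) (hT : T.IsSymmetric) {C D : ℝ} (hD : 0 ≤ D) (x : Y)
    (h : ∀ m : ℕ, ‖(T ^ m) x‖ ≤ C * D ^ m) : ‖T x‖ ≤ D * ‖x‖ := by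
  have hsq : ∀ m : ℕ, ‖(T ^ m) x‖ ^ 2 ≤ ‖x‖ * ‖(T ^ (2 * m)) x‖ := fun m => by
    have h1 : ⟪(T ^ m) x, (T ^ m) x⟫_ℂ = ⟪x, (T ^ (2 * m)) x⟫_ℂ := by
      rw [hT.pow m, two_mul, pow_add]; rfl
    rw [← inner_self_eq_norm_sq (𝕜 := ℂ), h1]
    exact (Complex.re_le_norm _).trans (norm_inner_le_norm _ _)
  rcases eq_or_lt_of_le (norm_nonneg x) with hx | hx
  -- The space is only seminormed: a null vector need not be zero, and Cauchy–Schwarz is needed to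
  -- see that its image is null too.
  · have := hsq 1
    rw [← hx, zero_mul, pow_one] at this
    rw [← hx, mul_zero]
    exact (pow_eq_zero_iff two_ne_zero).1 (le_antisymm this (sq_nonneg _)) |>.le
  rcases eq_or_lt_of_le hD with hD | hD
  · have := h 1
    simpa [← hD] using this
  -- Squaring and applying `hsq` doubles the exponent; both sides are multiplied by a power of ‖x‖
  -- so that no division occurs.
  have hpow : ∀ n : ℕ, ‖x‖ * ‖T x‖ ^ (2 ^ n) ≤ ‖x‖ ^ (2 ^ n) * ‖(T ^ (2 ^ n)) x‖ := by
    intro n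
    induction n with
    | zero => simp
    | succ n ih =>
      refine le_of_mul_le_mul_left ?_ hx
      calc ‖x‖ * (‖x‖ * ‖T x‖ ^ (2 ^ (n + 1))) = (‖x‖ * ‖T x‖ ^ (2 ^ n)) ^ 2 := by ring
        _ ≤ (‖x‖ ^ (2 ^ n) * ‖(T ^ (2 ^ n)) x‖) ^ 2 := by gcongr
        _ = ‖x‖ ^ (2 ^ (n + 1)) * ‖(T ^ (2 ^ n)) x‖ ^ 2 := by ring
        _ ≤ ‖x‖ ^ (2 ^ (n + 1)) * (‖x‖ * ‖(T ^ (2 * 2 ^ n)) x‖) := by gcongr; exact hsq _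
        _ = _ := by rw [show 2 * 2 ^ n = 2 ^ (n + 1) by ring]; ring
  by_contra! hlt
  have hq : 0 < D * ‖x‖ := by positivity
  have hr : 1 < ‖T x‖ / (D * ‖x‖) := (one_lt_div hq).2 hlt
  obtain ⟨n, hn⟩ := pow_unbounded_of_one_lt (C / ‖x‖) hr
  -- The ratio exceeds 1 and n < 2ⁿ, so its powers with exponent 2ⁿ are unbounded as well, whereas
  -- `hpow` bounds them all by C / ‖x‖.
  have h2 : (‖T x‖ / (D * ‖x‖)) ^ n ≤ (‖T x‖ / (D * ‖x‖)) ^ (2 ^ n) :=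
    pow_le_pow_right₀ hr.le Nat.lt_two_pow_self.le
  have h3 : (‖T x‖ / (D * ‖x‖)) ^ (2 ^ n) ≤ C / ‖x‖ := by
    rw [div_pow, div_le_div_iff₀ (by positivity) hx, mul_comm _ ‖x‖]
    refine (hpow n).trans ?_
    calc ‖x‖ ^ (2 ^ n) * ‖(T ^ (2 ^ n)) x‖ ≤ ‖x‖ ^ (2 ^ n) * (C * D ^ (2 ^ n)) := by
          gcongr; exact h _
      _ = _ := by ring
  linarith

end Symmetric

/-! ### The induced operators X ⊗ I on 𝓕(E) ⊗_σ H. -/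

section TensorOp
variable {K : Type u} [NormedAddCommGroup K] [InnerProductSpace ℂ K] [CompleteSpace K]
variable {M : VonNeumannAlgebra K} {E : Type u} [NormedAddCommGroup E] [NormedSpace ℂ E]
  [CompleteSpace E] [WStarCorrespondence M E]
  {H : Type w} [NormedAddCommGroup H] [InnerProductSpace ℂ H] [CompleteSpace H]
  {σ : Elem M →⋆ₙₐ[ℂ] (H →L[ℂ] H)}
open HilbertModule TensorProduct WStarCorrespondence

theorem Fock.norm_ip_le (x y : Fock M E) : ‖(ip x y : Elem M)‖ ≤ ‖x‖ * ‖y‖ := by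
  show ‖ContinuousLinearMap.adjoint x.val ∘L y.val‖ ≤ _
  refine (ContinuousLinearMap.opNorm_comp_le _ _).trans (le_of_eq ?_)
  rw [LinearIsometryEquiv.norm_map]
  rfl

/-- An adjoint of an adjointable operator on `𝓕(E)` has at most the same norm. -/
theorem Fock.norm_adjoint_le {S X : Fock M E →L[ℂ] Fock M E}
    (h : ∀ x y, (ip (S x) y : Elem M) = ip x (X y)) : ‖S‖ ≤ ‖X‖ := by
  refine ContinuousLinearMap.opNorm_le_bound _ (norm_nonneg _) fun x => ?_
  rcases eq_or_lt_of_le (norm_nonneg (S x)) with h0 | h0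
  · rw [← h0]; positivity
  refine le_of_mul_le_mul_right ?_ h0
  calc ‖S x‖ * ‖S x‖ = ‖(ip (S x) (S x) : Elem M)‖ := by rw [← norm_sq_eq, sq]
    _ = ‖(ip x (X (S x)) : Elem M)‖ := by rw [h]
    _ ≤ ‖x‖ * (‖X‖ * ‖S x‖) := (Fock.norm_ip_le _ _).trans (by gcongr; exact X.le_opNorm _)
    _ = _ := by ring

theorem form_rTensor_adjoint {F : Type v} [NormedAddCommGroup F] [NormedSpace ℂ F]
    [HilbertModule M F] {S X : F →L[ℂ] F}
    (h : ∀ x y, (ip (S x) y : Elem M) = ip x (X y)) (x y : F ⊗[ℂ] H) :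
    form M F σ (S.toLinearMap.rTensor H x) y = form M F σ x (X.toLinearMap.rTensor H y) := by
  induction x with
  | zero => simp
  | add x₁ x₂ h₁ h₂ => simp only [map_add, LinearMap.add_apply, h₁, h₂]
  | tmul ξ k =>
    induction y with
    | zero => simp
    | add y₁ y₂ h₁ h₂ => simp only [map_add, h₁, h₂]
    | tmul ζ l => simp only [LinearMap.rTensor_tmul, form_tmul, ContinuousLinearMap.coe_coe, h]

/-- A crude bound whose constant depends on a decomposition of `x` into elementary tensors. It is
enough for `norm_apply_le_of_pow_le`, where only the growth rate in m matters. -/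
theorem exists_norm_rTensor_le {F : Type v} [NormedAddCommGroup F] [NormedSpace ℂ F]
    [HilbertModule M F] (x : F ⊗[ℂ] H) :
    ∃ C, 0 ≤ C ∧ ∀ T : F →L[ℂ] F, ‖toPre M F σ (T.toLinearMap.rTensor H x)‖ ≤ C * ‖T‖ := by
  induction x with
  | zero => exact ⟨0, le_rfl, fun T => by simp⟩
  | add x y hx hy =>
    obtain ⟨C, hC, hx⟩ := hx
    obtain ⟨D, hD, hy⟩ := hy
    refine ⟨C + D, add_nonneg hC hD, fun T => ?_⟩
    rw [map_add, map_add, add_mul]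
    exact (norm_add_le _ _).trans (add_le_add (hx T) (hy T))
  | tmul ξ k =>
    refine ⟨‖ξ‖ * ‖k‖, by positivity, fun T => ?_⟩
    refine (norm_tmul_le _ _).trans ?_
    calc ‖T ξ‖ * ‖k‖ ≤ ‖T‖ * ‖ξ‖ * ‖k‖ := by gcongr; exact T.le_opNorm ξ
      _ = _ := by ring

/-- With S = X⋆, the operator SX ⊗ I is symmetric and its powers at `x` grow at most like ‖X‖^{2m},
so ‖(SX ⊗ I) x‖ ≤ ‖X‖² ‖x‖. Then ‖(X ⊗ I) x‖² = ⟨x, (SX ⊗ I) x⟩ gives the bound, without positive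
square roots in 𝓛(𝓕(E)). -/
theorem norm_rTensor_le (X : Adjointable M (Fock M E)) (x : Fock M E ⊗[ℂ] H) :
    ‖toPre M (Fock M E) σ ((X : Fock M E →L[ℂ] Fock M E).toLinearMap.rTensor H x)‖ ≤
      ‖X‖ * ‖toPre M (Fock M E) σ x‖ := by
  obtain ⟨X, S, hS⟩ := X
  show ‖toPre M (Fock M E) σ (X.toLinearMap.rTensor H x)‖ ≤ ‖X‖ * _
  have hS' : ∀ x y, (ip (X x) y : Elem M) = ip x (S y) := fun x y => by
    rw [← star_ip, ← hS, star_ip]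
  have hSX : ∀ x y, (ip ((S * X) x) y : Elem M) = ip x ((S * X) y) := fun x y => by
    show (ip (S (X x)) y : Elem M) = ip x (S (X y))
    rw [hS, hS']
  let T : PreTensor M (Fock M E) σ →ₗ[ℂ] PreTensor M (Fock M E) σ :=
    ((S * X).toLinearMap.rTensor H)
  have hT : T.IsSymmetric := fun x y => form_rTensor_adjoint (σ := σ) hSX x y
  have hTpow : ∀ m : ℕ, ((T ^ m) (toPre M (Fock M E) σ x)) =
      toPre M (Fock M E) σ (((S * X) ^ m).toLinearMap.rTensor H x) := fun m => by
    induction m with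
    | zero =>
      rw [pow_zero, pow_zero]
      exact (LinearMap.congr_fun (LinearMap.rTensor_id H (Fock M E)) x).symm
    | succ m ih =>
      rw [pow_succ', pow_succ', Module.End.mul_apply, ih]
      exact (LinearMap.rTensor_comp_apply H (S * X).toLinearMap _ x).symm
  obtain ⟨C, hC, hb⟩ := exists_norm_rTensor_le (M := M) (σ := σ) x
  have hSn : ‖S * X‖ ≤ ‖X‖ ^ 2 := (norm_mul_le _ _).trans (by
    rw [sq]; gcongr; exact Fock.norm_adjoint_le hS)
  have key : ‖T (toPre M (Fock M E) σ x)‖ ≤ ‖X‖ ^ 2 * ‖toPre M (Fock M E) σ x‖ := by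
    -- The maximum covers m = 0, where the operator is the identity, whose norm need not be 1 if the
    -- module is trivial.
    refine norm_apply_le_of_pow_le (C := max C (C * ‖(1 : Fock M E →L[ℂ] Fock M E)‖)) T hT
      (by positivity) _ fun m => ?_
    rw [hTpow]
    refine (hb _).trans ?_
    cases m with
    | zero => simp only [pow_zero, mul_one]; exact le_max_right _ _
    | succ m =>
      refine mul_le_mul (le_max_left _ _) ?_ (norm_nonneg _) (le_max_of_le_left hC)
      exact (norm_pow_le' _ m.succ_pos).trans (by gcongr)
  refine le_of_sq_le_sq ?_ (by positivity)
  have h1 : ‖toPre M (Fock M E) σ (X.toLinearMap.rTensor H x)‖ ^ 2 =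
      RCLike.re ⟪toPre M (Fock M E) σ x, T (toPre M (Fock M E) σ x)⟫_ℂ := by
    rw [pre_norm_sq, form_rTensor_adjoint hS']
    show (form M (Fock M E) σ x _).re = (form M (Fock M E) σ x _).re
    congr 2
    exact (LinearMap.rTensor_comp_apply H S.toLinearMap X.toLinearMap x).symm
  rw [h1]
  refine (re_inner_le_norm _ _).trans ?_
  calc _ ≤ ‖toPre M (Fock M E) σ x‖ * (‖X‖ ^ 2 * ‖toPre M (Fock M E) σ x‖) := by gcongr
    _ = _ := by ring

variable (σ) in
/-- The operator `X ⊗ I` on `𝓕(E) ⊗_σ H`. -/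
def tensorOp (X : Adjointable M (Fock M E)) :
    ITensor M (Fock M E) σ →L[ℂ] ITensor M (Fock M E) σ :=
  extendOp σ ((X : Fock M E →L[ℂ] Fock M E).toLinearMap.rTensor H) ‖X‖ (norm_rTensor_le X)

@[simp]
theorem tensorOp_tensorLeft (X : Adjointable M (Fock M E)) (x : Fock M E) (h : H) :
    tensorOp σ X (tensorLeft σ x h) = tensorLeft σ ((X : Fock M E →L[ℂ] Fock M E) x) h :=
  extendOp_tensorLeft _ _ _ _ _

theorem norm_tensorOp_le (X : Adjointable M (Fock M E)) : ‖tensorOp σ X‖ ≤ ‖X‖ := by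
  refine ContinuousLinearMap.opNorm_le_bound _ (norm_nonneg _) fun x => ?_
  refine UniformSpace.Completion.induction_on x
    (isClosed_le (by fun_prop) (by fun_prop)) fun y => ?_
  rw [tensorOp, extendOp, ContinuousLinearMap.completion_apply_coe,
    UniformSpace.Completion.norm_coe, UniformSpace.Completion.norm_coe]
  exact norm_rTensor_le (σ := σ) X ((toPre M (Fock M E) σ).symm y)

theorem tensorLeft_add_left {F : Type v} [NormedAddCommGroup F] [NormedSpace ℂ F]
    [HilbertModule M F] (x y : F) :
    tensorLeft σ (x + y) = tensorLeft σ x + tensorLeft σ y := by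
  ext h
  rw [add_apply, tensorLeft_apply, add_tmul, map_add, UniformSpace.Completion.coe_add]; rfl

theorem tensorLeft_smul_left {F : Type v} [NormedAddCommGroup F] [NormedSpace ℂ F]
    [HilbertModule M F] (c : ℂ) (x : F) : tensorLeft σ (c • x) = c • tensorLeft σ x := by
  ext h
  rw [smul_apply, tensorLeft_apply, ← smul_tmul', map_smul,
    UniformSpace.Completion.coe_smul]; rfl

variable (σ) in
/-- `X ↦ X ⊗ I` as a bounded linear map. -/
def tensorOpL : Adjointable M (Fock M E) →L[ℂ]
    (ITensor M (Fock M E) σ →L[ℂ] ITensor M (Fock M E) σ) :=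
  LinearMap.mkContinuous
    { toFun := tensorOp σ
      map_add' X Y := ITensor.clm_ext fun x h => by simp [tensorLeft_add_left]
      map_smul' c X := ITensor.clm_ext fun x h => by simp [tensorLeft_smul_left] }
    1 fun X => by rw [one_mul]; exact norm_tensorOp_le X

@[simp]
theorem tensorOpL_apply (X : Adjointable M (Fock M E)) : tensorOpL σ X = tensorOp σ X := rfl

theorem tensorOp_mul (X Y : Adjointable M (Fock M E)) :
    tensorOp σ (X * Y) = tensorOp σ X ∘L tensorOp σ Y :=
  ITensor.clm_ext fun x h => by simp

/-- Two vectors of `F ⊗_σ H` agree if they have the same inner products with elementary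
tensors. -/
theorem ITensor.ext_inner {F : Type v} [NormedAddCommGroup F] [NormedSpace ℂ F]
    [HilbertModule M F] {f g : ITensor M F σ}
    (h : ∀ x k, ⟪tensorLeft σ x k, f⟫_ℂ = ⟪tensorLeft σ x k, g⟫_ℂ) : f = g := by
  refine ext_inner_left ℂ fun y => ?_
  refine ITensor.induction (p := fun y => ⟪y, f⟫_ℂ = ⟪y, g⟫_ℂ)
    (isClosed_eq (by fun_prop) (by fun_prop)) (by simp)
    (fun x x' h h' => by simp only [inner_add_left, h, h']) h y

theorem adjoint_tensorOp {S X : Adjointable M (Fock M E)}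
    (h : ∀ x y, (ip ((S : Fock M E →L[ℂ] Fock M E) x) y : Elem M) =
      ip x ((X : Fock M E →L[ℂ] Fock M E) y)) :
    ContinuousLinearMap.adjoint (tensorOp σ X) = tensorOp σ S := by
  refine ITensor.clm_ext fun x k => ITensor.ext_inner fun y l => ?_
  rw [ContinuousLinearMap.adjoint_inner_right, tensorOp_tensorLeft, tensorOp_tensorLeft,
    inner_tensorLeft, inner_tensorLeft, ← star_ip, ← h, star_ip]

/-- The tensor product is balanced over `M`, although it was built over ℂ: both vectors have the
same inner products with elementary tensors, and the completion is separated. -/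
theorem tensorLeft_rsmul {F : Type v} [NormedAddCommGroup F] [NormedSpace ℂ F]
    [HilbertModule M F] (x : F) (a : Elem M) (h : H) :
    tensorLeft σ (rsmul x a) h = tensorLeft σ x (σ a h) := by
  refine ITensor.ext_inner fun y l => ?_
  rw [inner_tensorLeft, inner_tensorLeft, ip_rsmul_right, map_mul]
  rfl

/-- Composing this slice map with a vector functional of `M` gives one of the functionals that
define the ultraweak topology on 𝓛(𝓕(E)). -/
theorem continuous_ip_apply (x y : Fock M E) :
    Continuous[ultraweakAdj M (Fock M E), ultraweakElem M]
      fun X : Adjointable M (Fock M E) => (ip x ((X : Fock M E →L[ℂ] Fock M E) y) : Elem M) := by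
  let T : Adjointable M (Fock M E) →L[ℂ] Elem M := LinearMap.mkContinuous
    { toFun := fun X => (ip x ((X : Fock M E →L[ℂ] Fock M E) y) : Elem M)
      map_add' X Y := ip_add_right x _ _
      map_smul' c X := ip_smul_right c x _ } (‖x‖ * ‖y‖) fun X => by
    refine (Fock.norm_ip_le _ _).trans ?_
    have : ‖(X : Fock M E →L[ℂ] Fock M E) y‖ ≤ ‖X‖ * ‖y‖ := ContinuousLinearMap.le_opNorm _ _
    refine (mul_le_mul_of_nonneg_left this (norm_nonneg x)).trans_eq ?_
    show ‖x‖ * (‖(X : Fock M E →L[ℂ] Fock M E)‖ * ‖y‖) =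
      ‖x‖ * ‖y‖ * ‖(X : Fock M E →L[ℂ] Fock M E)‖
    ring
  refine continuous_weakTopology_of_comp_mem T fun f hf => ?_
  obtain ⟨h, k, hf⟩ := hf
  exact subset_predual ⟨x, y, h, k, fun X => hf _⟩

/-- The functional `X ↦ ⟪f, τ(X) g⟫`. -/
def vectorFunctional {A : Type*} [SeminormedAddCommGroup A] [NormedSpace ℂ A] {L : Type*}
    [NormedAddCommGroup L] [InnerProductSpace ℂ L] (τ : A →L[ℂ] (L →L[ℂ] L)) (f g : L) :
    StrongDual ℂ A :=
  innerSL ℂ f ∘L (ContinuousLinearMap.apply ℂ _ g) ∘L τ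

theorem vectorFunctional_apply {A : Type*} [SeminormedAddCommGroup A] [NormedSpace ℂ A]
    {L : Type*} [NormedAddCommGroup L] [InnerProductSpace ℂ L] (τ : A →L[ℂ] (L →L[ℂ] L))
    (f g : L) (X : A) : vectorFunctional τ f g X = ⟪f, τ X g⟫_ℂ := rfl

/-- Elementary tensors are total, and the functional depends continuously and additively on each of
its two vectors, so membership in a closed subspace extends one vector at a time. -/
theorem vectorFunctional_mem {A : Type*} [SeminormedAddCommGroup A] [NormedSpace ℂ A]
    {F : Type v} [NormedAddCommGroup F] [NormedSpace ℂ F] [HilbertModule M F]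
    (P : Submodule ℂ (StrongDual ℂ A)) (hP : IsClosed (P : Set (StrongDual ℂ A)))
    (τ : A →L[ℂ] (ITensor M F σ →L[ℂ] ITensor M F σ))
    (h : ∀ x h y k, vectorFunctional τ (tensorLeft σ x h) (tensorLeft σ y k) ∈ P)
    (f g : ITensor M F σ) : vectorFunctional τ f g ∈ P := by
  refine ITensor.induction (p := fun f => vectorFunctional τ f g ∈ P)
    (hP.preimage (by unfold vectorFunctional; fun_prop)) ?_ ?_ (fun x k => ?_) f
  · simp [vectorFunctional]
  · intro x y hx hy
    convert add_mem hx hy using 1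
    ext X
    simp [vectorFunctional_apply]
  refine ITensor.induction (p := fun g => vectorFunctional τ (tensorLeft σ x k) g ∈ P)
    (hP.preimage (by unfold vectorFunctional; fun_prop)) ?_ ?_ (fun y l => h x k y l) g
  · simp [vectorFunctional]
  · intro x y hx hy
    convert add_mem hx hy using 1
    ext X
    simp [vectorFunctional_apply]

variable (M E) in
/-- The functionals `T ↦ ω(⟨x, T y⟩)` on `𝓛(𝓕(E))` that define its ultraweak topology. -/
abbrev adjFunctionals : Set (StrongDual ℂ (Adjointable M (Fock M E))) :=
  {f | ∃ (x y : Fock M E) (h k : K), ∀ T : Adjointable M (Fock M E),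
    f T = ⟪h, (ip (M := M) x ((T : Fock M E →L[ℂ] Fock M E) y) : K →L[ℂ] K) k⟫_ℂ}

/-- For a normal representation `σ`, the functionals `X ↦ ⟪f, (X ⊗ I) g⟫` belong to the predual of
`𝓛(𝓕(E))`. -/
theorem vectorFunctional_tensorOpL_mem (hσ : Continuous[ultraweakElem M, ultraweak H] σ)
    (f g : ITensor M (Fock M E) σ) :
    vectorFunctional (tensorOpL σ) f g ∈ predual (adjFunctionals M E) := by
  refine vectorFunctional_mem _ (isClosed_predual _) _ (fun x h y k => ?_) f g
  -- On elementary tensors the functional is X ↦ ⟨h, σ(⟨x, X y⟩) k⟩, continuous by normality of σ.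
  -- Continuity is converted to membership in the predual because the latter survives norm limits of
  -- the two vectors.
  refine mem_of_continuous_weakTopology ?_
  have h1 : Continuous[ultraweak H, inferInstance] fun T : H →L[ℂ] H => ⟪h, T k⟫_ℂ :=
    continuous_weakTopology_apply (f := innerSL ℂ h ∘L ContinuousLinearMap.apply ℂ _ k)
      (subset_predual ⟨h, k, fun _ => rfl⟩)
  have h2 : ⇑(vectorFunctional (tensorOpL σ) (tensorLeft σ x h) (tensorLeft σ y k)) =
      fun X : Adjointable M (Fock M E) => ⟪h, σ (ip x ((X : Fock M E →L[ℂ] Fock M E) y)) k⟫_ℂ := funext fun X => by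
    rw [vectorFunctional_apply, tensorOpL_apply, tensorOp_tensorLeft, inner_tensorLeft]
  rw [h2]
  exact @Continuous.comp _ _ _ (ultraweakAdj M (Fock M E)) (ultraweak H) _ _ _ h1
    (@Continuous.comp _ _ _ (ultraweakAdj M (Fock M E)) (ultraweakElem M) (ultraweak H) _ _ hσ
      (continuous_ip_apply x y))

theorem continuous_inner_tensorOp (hσ : Continuous[ultraweakElem M, ultraweak H] σ)
    (f g : ITensor M (Fock M E) σ) :
    Continuous[ultraweakAdj M (Fock M E), inferInstance] fun X => ⟪f, tensorOp σ X g⟫_ℂ :=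
  continuous_weakTopology_apply (f := vectorFunctional (tensorOpL σ) f g)
    (vectorFunctional_tensorOpL_mem hσ f g)

end TensorOp

/-! ### A contraction principle on closed subspaces. -/

section FixedPoint

/-- The equation `y = v + f y` in a closed space of operators is solvable if `f` is a strict
contraction. -/
theorem exists_eq_add_of_norm_le {X : Type v} [NormedAddCommGroup X] [NormedSpace ℂ X]
    {G : Type w} [NormedAddCommGroup G] [NormedSpace ℂ G] [CompleteSpace G]
    (Y : Submodule ℂ (X →L[ℂ] G)) (hY : IsClosed (Y : Set (X →L[ℂ] G))) (f : Y →ₗ[ℂ] Y) {c : ℝ}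
    (hc : c < 1) (hf : ∀ y, ‖f y‖ ≤ c * ‖y‖) (v : Y) : ∃ y, y = v + f y := by
  have : CompleteSpace Y := hY.completeSpace_coe
  have h : ContractingWith c.toNNReal fun y => v + f y := by
    refine ⟨by simpa using hc, LipschitzWith.of_dist_le_mul fun y z => ?_⟩
    rw [dist_add_left, dist_eq_norm, dist_eq_norm, ← map_sub]
    exact (hf _).trans (mul_le_mul_of_nonneg_right (Real.le_coe_toNNReal c) (norm_nonneg _))
  exact ⟨h.fixedPoint, h.fixedPoint_isFixedPt.symm⟩

end FixedPoint

/-! ### Creation operators and the vacuum after tensoring with H. -/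

section Kernel
variable {K : Type u} [NormedAddCommGroup K] [InnerProductSpace ℂ K] [CompleteSpace K]
variable {M : VonNeumannAlgebra K} {E : Type u} [NormedAddCommGroup E] [NormedSpace ℂ E]
  [CompleteSpace E] [WStarCorrespondence M E]
  {H : Type w} [NormedAddCommGroup H] [InnerProductSpace ℂ H] [CompleteSpace H]
  {σ : Elem M →⋆ₙₐ[ℂ] (H →L[ℂ] H)}
open HilbertModule TensorProduct WStarCorrespondence

theorem adjoint_phiInf (a : Elem M) :
    ContinuousLinearMap.adjoint (tensorOp σ (phiInf E a)) = tensorOp σ (phiInf E (star a)) := by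
  refine adjoint_tensorOp fun x y => Subtype.ext ?_
  show ContinuousLinearMap.adjoint (diag M E (star a) ∘L x.val) ∘L y.val =
    ContinuousLinearMap.adjoint x.val ∘L (diag M E a ∘L y.val)
  rw [ContinuousLinearMap.adjoint_comp, adjoint_diag, star_star]
  rfl

theorem phiInf_mul_creation (a : Elem M) (ξ : E) :
    phiInf E a * creation M ξ = creation M (leftAct a ξ) := by
  refine Subtype.ext (ContinuousLinearMap.ext fun x => Fock.ext ?_)
  show diag M E a ∘L (shift M ξ ∘L x.val) = shift M (leftAct a ξ) ∘L x.val
  rw [← diag_shift]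
  rfl

theorem levelLeft_add (ξ ζ : E) (n : ℕ) :
    levelLeft M (ξ + ζ) n = levelLeft M ξ n + levelLeft M ζ n :=
  tensorLeft_add_left ξ ζ

theorem levelLeft_smul (c : ℂ) (ξ : E) (n : ℕ) :
    levelLeft M (c • ξ) n = c • levelLeft M ξ n :=
  tensorLeft_smul_left c ξ

theorem shift_add (ξ ζ : E) : shift M (ξ + ζ) = shift M ξ + shift M ζ := by
  ext f n
  cases n with
  | zero => exact (add_zero (0 : Level M E 0)).symm
  | succ n => exact congrArg (· (f n)) (levelLeft_add ξ ζ n)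

theorem shift_smul (c : ℂ) (ξ : E) : shift M (c • ξ) = c • shift M ξ := by
  ext f n
  cases n with
  | zero => exact (smul_zero (A := Level M E 0) c).symm
  | succ n => exact congrArg (· (f n)) (levelLeft_smul c ξ n)

theorem creation_add (ξ ζ : E) : creation M (ξ + ζ) = creation M ξ + creation M ζ := by
  refine Subtype.ext (ContinuousLinearMap.ext fun x => Fock.ext ?_)
  show shift M (ξ + ζ) ∘L x.val = shift M ξ ∘L x.val + shift M ζ ∘L x.val
  rw [shift_add, ContinuousLinearMap.add_comp]

theorem creation_smul (c : ℂ) (ξ : E) : creation M (c • ξ) = c • creation M ξ := by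
  refine Subtype.ext (ContinuousLinearMap.ext fun x => Fock.ext ?_)
  show shift M (c • ξ) ∘L x.val = c • (shift M ξ ∘L x.val)
  rw [shift_smul, ContinuousLinearMap.smul_comp]

theorem adjoint_creation_creation (ξ ζ : E) :
    ContinuousLinearMap.adjoint (tensorOp σ (creation M ξ)) ∘L tensorOp σ (creation M ζ) =
      tensorOp σ (phiInf E (ip ξ ζ)) := by
  refine ITensor.clm_ext fun y k => ITensor.ext_inner fun x h => ?_
  rw [ContinuousLinearMap.comp_apply, ContinuousLinearMap.adjoint_inner_right,
    tensorOp_tensorLeft, tensorOp_tensorLeft, tensorOp_tensorLeft, inner_tensorLeft,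
    inner_tensorLeft]
  congr 3
  refine Subtype.ext ?_
  show ContinuousLinearMap.adjoint (shift M ξ ∘L x.val) ∘L (shift M ζ ∘L y.val) =
    ContinuousLinearMap.adjoint x.val ∘L (diag M E (ip ξ ζ) ∘L y.val)
  rw [ContinuousLinearMap.adjoint_comp, ← adjoint_shift_shift]
  rfl

variable (M E) in
/-- The vacuum vector `1 ∈ M ⊆ 𝓕(E)`. -/
def Fock.vac : Fock M E :=
  Fock.mk (elemTensor M ([] : List E) 1) (algFock_le_fock M E (Submodule.subset_span ⟨_, _, rfl⟩))

theorem ip_vac_vac : (ip (Fock.vac M E) (Fock.vac M E) : Elem M) = 1 :=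
  Subtype.ext (adjoint_vacuum_vacuum (E := E) M)

theorem ip_creation_vac (ξ : E) (x : Fock M E) :
    (ip ((creation M ξ : Fock M E →L[ℂ] Fock M E) x) (Fock.vac M E) : Elem M) = 0 := by
  refine Subtype.ext ?_
  show ContinuousLinearMap.adjoint (shift M ξ ∘L x.val) ∘L
    (vacuum M E ∘L ((1 : Elem M) : K →L[ℂ] K)) = 0
  rw [ContinuousLinearMap.adjoint_comp, ContinuousLinearMap.comp_assoc,
    ← ContinuousLinearMap.comp_assoc _ (vacuum M E), adjoint_shift_vacuum,
    ContinuousLinearMap.zero_comp, ContinuousLinearMap.comp_zero]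

theorem phiInf_vac (a : Elem M) :
    (phiInf E a : Fock M E →L[ℂ] Fock M E) (Fock.vac M E) = rsmul (Fock.vac M E) a := by
  refine Fock.ext ?_
  show diag M E a ∘L (vacuum M E ∘L ((1 : Elem M) : K →L[ℂ] K)) =
    (vacuum M E ∘L ((1 : Elem M) : K →L[ℂ] K)) ∘L (a : K →L[ℂ] K)
  rw [← ContinuousLinearMap.comp_assoc, diag_vacuum]
  rfl

variable (E σ) in
/-- The embedding `h ↦ 1 ⊗ h` of `H` into `𝓕(E) ⊗_σ H`. -/
def vacEmb : H →L[ℂ] ITensor M (Fock M E) σ := tensorLeft σ (Fock.vac M E)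

/-- Here nondegeneracy of σ enters: ⟨1, 1⟩ is the unit of `M`, and σ must send it to I for the
vacuum embedding to be isometric. -/
theorem inner_vacEmb (hσ : σ 1 = 1) (h k : H) :
    ⟪vacEmb E σ h, vacEmb E σ k⟫_ℂ = ⟪h, k⟫_ℂ := by
  rw [vacEmb, inner_tensorLeft, ip_vac_vac, hσ]
  rfl

theorem phiInf_vacEmb (a : Elem M) :
    tensorOp σ (phiInf E a) ∘L vacEmb E σ = vacEmb E σ ∘L σ a := by
  ext1 h
  rw [ContinuousLinearMap.comp_apply, vacEmb, tensorOp_tensorLeft, phiInf_vac, tensorLeft_rsmul]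
  rfl

theorem inner_creation_vacEmb (ξ : E) (f : ITensor M (Fock M E) σ) (h : H) :
    ⟪tensorOp σ (creation M ξ) f, vacEmb E σ h⟫_ℂ = 0 := by
  refine ITensor.induction (p := fun f => ⟪tensorOp σ (creation M ξ) f, vacEmb E σ h⟫_ℂ = 0)
    (isClosed_eq (by fun_prop) (by fun_prop)) (by simp)
    (fun x y hx hy => by rw [map_add, inner_add_left, hx, hy, add_zero]) (fun x k => ?_) f
  rw [tensorOp_tensorLeft, vacEmb, inner_tensorLeft, ip_creation_vac, map_zero]
  exact inner_zero_right _

/-! ### Intertwiners of σ and φ_∞ ⊗ I, and creation applied to them. -/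

variable (E σ) in
/-- The operators `P : H → 𝓕(E) ⊗_σ H` with `(φ_∞(a) ⊗ I) P = P σ(a)`. -/
def intertwiners : Submodule ℂ (H →L[ℂ] ITensor M (Fock M E) σ) where
  carrier := {P | ∀ a, tensorOp σ (phiInf E a) ∘L P = P ∘L σ a}
  zero_mem' a := by simp
  add_mem' h h' a := by
    rw [ContinuousLinearMap.add_comp, ContinuousLinearMap.comp_add, h a, h' a]
  smul_mem' c P h a := by
    rw [ContinuousLinearMap.smul_comp, ContinuousLinearMap.comp_smul, h a]

theorem isClosed_intertwiners :
    IsClosed (intertwiners E σ : Set (H →L[ℂ] ITensor M (Fock M E) σ)) := by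
  have : (intertwiners E σ : Set (H →L[ℂ] ITensor M (Fock M E) σ)) =
      ⋂ a, {P | tensorOp σ (phiInf E a) ∘L P = P ∘L σ a} := by
    ext P
    simp only [Set.mem_iInter]
    rfl
  rw [this]
  exact isClosed_iInter fun a => isClosed_eq (by fun_prop) (by fun_prop)

/-- The operator `P⋆ P ∈ σ(M)'`. -/
def gram (P : intertwiners E σ) : H →L[ℂ] H :=
  ContinuousLinearMap.adjoint (P : H →L[ℂ] ITensor M (Fock M E) σ) ∘L
    (P : H →L[ℂ] ITensor M (Fock M E) σ)

theorem inner_gram (P : intertwiners E σ) (h k : H) :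
    ⟪h, gram P k⟫_ℂ = ⟪P.1 h, P.1 k⟫_ℂ := by
  rw [gram, ContinuousLinearMap.comp_apply, ContinuousLinearMap.adjoint_inner_right]

theorem gram_comm (P : intertwiners E σ) (m : Elem M) : σ m * gram P = gram P * σ m := by
  have h := congrArg ContinuousLinearMap.adjoint (P.2 (star m))
  rw [ContinuousLinearMap.adjoint_comp, ContinuousLinearMap.adjoint_comp, map_star σ,
    ContinuousLinearMap.star_eq_adjoint, ContinuousLinearMap.adjoint_adjoint, adjoint_phiInf,
    star_star] at h
  show σ m ∘L _ = _ ∘L σ m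
  rw [gram, ← ContinuousLinearMap.comp_assoc, ← h, ContinuousLinearMap.comp_assoc,
    ContinuousLinearMap.comp_assoc, P.2 m]

theorem norm_gram (P : intertwiners E σ) : ‖gram P‖ = ‖P‖ ^ 2 := by
  rw [gram, ContinuousLinearMap.norm_adjoint_comp_self, sq]
  rfl

/-- The linear map `ξ ⊗ h ↦ (T_ξ ⊗ I) P h` on the algebraic tensor product. -/
def creationLift (P : H →L[ℂ] ITensor M (Fock M E) σ) :
    E ⊗[ℂ] H →ₗ[ℂ] ITensor M (Fock M E) σ :=
  lift (LinearMap.mk₂ ℂ (fun ξ h => tensorOp σ (creation M ξ) (P h))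
    (fun ξ ζ h => by rw [creation_add, ← tensorOpL_apply, map_add]; rfl)
    (fun c ξ h => by rw [creation_smul, ← tensorOpL_apply, map_smul]; rfl)
    (fun ξ h k => by rw [map_add, map_add])
    (fun c ξ h => by rw [map_smul, map_smul]))

@[simp]
theorem creationLift_tmul (P : H →L[ℂ] ITensor M (Fock M E) σ) (ξ : E) (h : H) :
    creationLift P (ξ ⊗ₜ h) = tensorOp σ (creation M ξ) (P h) := rfl

/-- By T_ξ⋆ T_ζ = φ_∞(⟨ξ, ζ⟩) the left side on elementary tensors is ⟨P h, (φ_∞(⟨ξ, ζ⟩) ⊗ I) P k⟩.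
The intertwining property turns this into ⟨h, P⋆P σ(⟨ξ, ζ⟩) k⟩, and P⋆P commutes with σ(M). -/
theorem inner_creationLift (P : intertwiners E σ) (x y : E ⊗[ℂ] H) :
    ⟪creationLift P.1 x, creationLift P.1 y⟫_ℂ =
      form M E σ x ((gram P).toLinearMap.lTensor E y) := by
  induction x with
  | zero => simp
  | add x₁ x₂ h₁ h₂ => simp only [map_add, LinearMap.add_apply, inner_add_left, h₁, h₂]
  | tmul ξ h =>
    induction y with
    | zero => simp
    | add y₁ y₂ h₁ h₂ => simp only [map_add, inner_add_right, h₁, h₂]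
    | tmul ζ k =>
      rw [creationLift_tmul, creationLift_tmul, LinearMap.lTensor_tmul, form_tmul,
        ← ContinuousLinearMap.adjoint_inner_right, ← ContinuousLinearMap.comp_apply
          (ContinuousLinearMap.adjoint (tensorOp σ (creation M ξ))), adjoint_creation_creation]
      have h1 : tensorOp σ (phiInf E (ip ξ ζ)) (P.1 k) = P.1 (σ (ip ξ ζ) k) :=
        congrArg (· k) (P.2 (ip ξ ζ))
      have h2 : σ (ip ξ ζ) (gram P k) = gram P (σ (ip ξ ζ) k) :=
        congrArg (· k) (gram_comm P (ip ξ ζ))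
      rw [h1, ContinuousLinearMap.coe_coe, h2, inner_gram]

/-- The squared norm is the form of I ⊗ P⋆P at `x`, and ‖I ⊗ P⋆P‖ ≤ ‖P⋆P‖ = ‖P‖². This allows the
extension to the completion with no loss in norm. -/
theorem norm_creationLift_le (P : intertwiners E σ) (x : E ⊗[ℂ] H) :
    ‖creationLift P.1 x‖ ≤ ‖P‖ * ‖toPre M E σ x‖ := by
  refine le_of_sq_le_sq ?_ (by positivity)
  rw [← inner_self_eq_norm_sq (𝕜 := ℂ), inner_creationLift, ← pre_inner]
  refine (re_inner_le_norm _ _).trans ?_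
  calc _ ≤ ‖toPre M E σ x‖ * (‖gram P‖ * ‖toPre M E σ x‖) := by
        gcongr; exact norm_amplify_le _ (gram_comm P) x
    _ = _ := by rw [norm_gram]; ring

variable (M E σ) in
/-- The canonical linear map from `E ⊗ H` to the Hilbert space `E ⊗_σ H`. -/
def toITensor : E ⊗[ℂ] H →ₗ[ℂ] ITensor M E σ :=
  (UniformSpace.Completion.toComplL (𝕜 := ℂ) (E := PreTensor M E σ)).toLinearMap ∘ₗ
    (toPre M E σ).toLinearMap

theorem norm_toITensor (x : E ⊗[ℂ] H) : ‖toITensor M E σ x‖ = ‖toPre M E σ x‖ :=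
  UniformSpace.Completion.norm_coe _

theorem denseRange_toITensor : DenseRange (toITensor M E σ) :=
  UniformSpace.Completion.denseRange_coe.comp (toPre M E σ).surjective.denseRange
    (UniformSpace.Completion.continuous_coe _)

/-- The operator `ξ ⊗ h ↦ (T_ξ ⊗ I) P h` from `E ⊗_σ H` to `𝓕(E) ⊗_σ H`. -/
def creationOp (P : intertwiners E σ) : ITensor M E σ →L[ℂ] ITensor M (Fock M E) σ :=
  (creationLift P.1).extendOfNorm (toITensor M E σ)

theorem creationOp_tensorLeft (P : intertwiners E σ) (ξ : E) (h : H) :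
    creationOp P (tensorLeft σ ξ h) = tensorOp σ (creation M ξ) (P.1 h) :=
  LinearMap.extendOfNorm_eq denseRange_toITensor
    ⟨‖P‖, fun x => by rw [norm_toITensor]; exact norm_creationLift_le P x⟩ (ξ ⊗ₜ h)

theorem norm_creationOp_le (P : intertwiners E σ) : ‖creationOp P‖ ≤ ‖P‖ :=
  LinearMap.opNorm_extendOfNorm_le denseRange_toITensor (norm_nonneg _)
    fun x => by rw [norm_toITensor]; exact norm_creationLift_le P x

theorem creationOp_add (P Q : intertwiners E σ) :
    creationOp (P + Q) = creationOp P + creationOp Q :=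
  ITensor.clm_ext fun ξ h => by simp [creationOp_tensorLeft]

theorem creationOp_smul (c : ℂ) (P : intertwiners E σ) :
    creationOp (c • P) = c • creationOp P :=
  ITensor.clm_ext fun ξ h => by simp [creationOp_tensorLeft]

theorem inner_creationOp (P : intertwiners E σ) (x y : ITensor M E σ) :
    ⟪creationOp P x, creationOp P y⟫_ℂ = ⟪x, amplify E (gram P) (gram_comm P) y⟫_ℂ := by
  refine ITensor.induction (p := fun x => ⟪creationOp P x, creationOp P y⟫_ℂ =
    ⟪x, amplify E (gram P) (gram_comm P) y⟫_ℂ)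
    (isClosed_eq (by fun_prop) (by fun_prop)) (by simp)
    (fun x x' h h' => by simp only [map_add, inner_add_left, h, h']) (fun ξ h => ?_) x
  refine ITensor.induction (p := fun y => ⟪creationOp P (tensorLeft σ ξ h), creationOp P y⟫_ℂ =
    ⟪tensorLeft σ ξ h, amplify E (gram P) (gram_comm P) y⟫_ℂ)
    (isClosed_eq (by fun_prop) (by fun_prop)) (by simp)
    (fun x x' h h' => by simp only [map_add, inner_add_right, h, h']) (fun ζ k => ?_) y
  rw [amplify_tensorLeft, inner_tensorLeft, creationOp_tensorLeft, creationOp_tensorLeft,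
    ← creationLift_tmul, ← creationLift_tmul, inner_creationLift]
  rfl

theorem phiInf_creationOp (a : Elem M) (P : intertwiners E σ) :
    tensorOp σ (phiInf E a) ∘L creationOp P = creationOp P ∘L inducedRep E σ a :=
  ITensor.clm_ext fun ξ h => by
    rw [ContinuousLinearMap.comp_apply, ContinuousLinearMap.comp_apply, inducedRep_tensorLeft,
      creationOp_tensorLeft, creationOp_tensorLeft, ← phiInf_mul_creation, tensorOp_mul]
    rfl

/-- On ζ ⊗ k, T_ξ⋆ T_ζ produces φ_∞(⟨ξ, ζ⟩), which passes through `P` as σ(⟨ξ, ζ⟩) = L_ξ⋆ L_ζ. This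
is the source of the kernel relation for creation operators. -/
theorem adjoint_creation_creationOp (ξ : E) (P : intertwiners E σ) :
    ContinuousLinearMap.adjoint (tensorOp σ (creation M ξ)) ∘L creationOp P =
      P.1 ∘L ContinuousLinearMap.adjoint (tensorLeft σ ξ) :=
  ITensor.clm_ext fun ζ k => by
    rw [ContinuousLinearMap.comp_apply, ContinuousLinearMap.comp_apply, creationOp_tensorLeft,
      ← ContinuousLinearMap.comp_apply (ContinuousLinearMap.adjoint (tensorOp σ (creation M ξ))),
      adjoint_creation_creation,
      ← ContinuousLinearMap.comp_apply (ContinuousLinearMap.adjoint (tensorLeft σ ξ)),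
      adjoint_tensorLeft_comp]
    exact congrArg (· k) (P.2 (ip ξ ζ))

/-- This orthogonality removes the cross terms when Q⋆Q is computed in `gram_eq`. -/
theorem inner_creationOp_vacEmb (P : intertwiners E σ) (x : ITensor M E σ) (h : H) :
    ⟪creationOp P x, vacEmb E σ h⟫_ℂ = 0 := by
  refine ITensor.induction (p := fun x => ⟪creationOp P x, vacEmb E σ h⟫_ℂ = 0)
    (isClosed_eq (by fun_prop) (by fun_prop)) (by simp)
    (fun x y hx hy => by rw [map_add, inner_add_left, hx, hy, add_zero]) (fun ξ k => ?_) x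
  rw [creationOp_tensorLeft, inner_creation_vacEmb]

/-- The defining relation of E^σ is used here: φ_∞(a) ⊗ I passes through `creationOp P` as φ(a) ⊗ I,
and then through `η` as σ(a). -/
theorem creationOp_comp_mem (η : sigmaDual E σ) (P : intertwiners E σ) :
    creationOp P ∘L η.1 ∈ intertwiners E σ := fun a => by
  rw [← ContinuousLinearMap.comp_assoc, phiInf_creationOp, ContinuousLinearMap.comp_assoc,
    ← η.2 a, ContinuousLinearMap.comp_assoc]

/-- The operator `P ↦ (ξ ⊗ h ↦ (T_ξ ⊗ I) P h) η` on the space of intertwiners. -/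
def creationMap (η : sigmaDual E σ) : intertwiners E σ →ₗ[ℂ] intertwiners E σ where
  toFun P := ⟨creationOp P ∘L η.1, creationOp_comp_mem η P⟩
  map_add' P Q := Subtype.ext (by
    show creationOp (P + Q) ∘L η.1 = creationOp P ∘L η.1 + creationOp Q ∘L η.1
    rw [creationOp_add, ContinuousLinearMap.add_comp])
  map_smul' c P := Subtype.ext (by
    show creationOp (c • P) ∘L η.1 = c • (creationOp P ∘L η.1)
    rw [creationOp_smul, ContinuousLinearMap.smul_comp])

/-- For ‖η‖ < 1 this makes the equation of the Poisson kernel a strict contraction. -/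
theorem norm_creationMap_le (η : sigmaDual E σ) (P : intertwiners E σ) :
    ‖creationMap η P‖ ≤ ‖η‖ * ‖P‖ := by
  show ‖creationOp P ∘L η.1‖ ≤ ‖η‖ * ‖P‖
  refine (ContinuousLinearMap.opNorm_comp_le _ _).trans ?_
  rw [mul_comm]
  exact mul_le_mul_of_nonneg_left (norm_creationOp_le P) (norm_nonneg _)

theorem norm_amplify_opNorm_le (S : H →L[ℂ] H) (hS : ∀ a, σ a * S = S * σ a) :
    ‖amplify E S hS‖ ≤ ‖S‖ := by
  refine ContinuousLinearMap.opNorm_le_bound _ (norm_nonneg _) fun x => ?_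
  refine UniformSpace.Completion.induction_on x
    (isClosed_le (by fun_prop) (by fun_prop)) fun y => ?_
  rw [amplify, extendOp, ContinuousLinearMap.completion_apply_coe,
    UniformSpace.Completion.norm_coe, UniformSpace.Completion.norm_coe]
  exact norm_amplify_le S hS ((toPre M E σ).symm y)

/-- A positive element of `σ(M)'` is of the form `D⋆ D` with `D ∈ σ(M)'`. -/
theorem exists_sqrt (b : commutant σ) (hb : 0 ≤ (b : H →L[ℂ] H)) :
    ∃ D : H →L[ℂ] H, (∀ m, σ m * D = D * σ m) ∧ ContinuousLinearMap.adjoint D ∘L D = b := by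
  refine ⟨CFC.sqrt (b : H →L[ℂ] H), fun m => ?_, ?_⟩
  -- The square root is a continuous function of `b`, so it commutes with whatever commutes with
  -- `b`.
  · have h1 : Commute (b : H →L[ℂ] H) (σ m) := (commutant_comm b m).symm
    exact (h1.cfcₙ_nnreal _).symm
  · have h2 : ContinuousLinearMap.adjoint (CFC.sqrt (b : H →L[ℂ] H)) = CFC.sqrt (b : H →L[ℂ] H) :=
      (CFC.sqrt_nonneg _).isSelfAdjoint
    rw [h2]
    exact CFC.sqrt_mul_sqrt_self _ hb

theorem inner_dualIp_dualAct (η : sigmaDual E σ) (a : commutant σ) (h k : H) :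
    ⟪h, (dualIp η (dualAct a η) : H →L[ℂ] H) k⟫_ℂ =
      ⟪η.1 h, amplify E (a : H →L[ℂ] H) (commutant_comm a) (η.1 k)⟫_ℂ := by
  show ⟪h, ContinuousLinearMap.adjoint η.1 _⟫_ℂ = _
  rw [ContinuousLinearMap.adjoint_inner_right]
  rfl

/-! ### Weighted Poisson kernels. -/

/-- `Q` intertwines the adjoints of `η⋆ × σ` and of the induced representation of `H^∞(E)` on the
generators. -/
structure IsKernel (η : sigmaDual E σ) (Q : H →L[ℂ] ITensor M (Fock M E) σ) : Prop where
  creation : ∀ ξ, ContinuousLinearMap.adjoint (tensorOp σ (creation M ξ)) ∘L Q =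
    Q ∘L ContinuousLinearMap.adjoint (tensorLeft σ ξ) ∘L η.1
  phi : ∀ a, tensorOp σ (phiInf E a) ∘L Q = Q ∘L σ a

/-- An operator with the intertwining property of a Poisson kernel is one. -/
theorem isKernel_of_eq {η : sigmaDual E σ} {Q : intertwiners E σ} {D : H →L[ℂ] H}
    (hQ : Q.1 = vacEmb E σ ∘L D + creationOp Q ∘L η.1) : IsKernel η Q.1 := by
  refine ⟨fun ξ => ?_, Q.2⟩
  -- Adjoints of creation operators annihilate the vacuum, so the defect operator `D` drops out of
  -- the relation.
  have h0 : ContinuousLinearMap.adjoint (tensorOp σ (creation M ξ)) ∘L vacEmb E σ = 0 := by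
    ext1 h
    refine ext_inner_left ℂ fun f => ?_
    rw [ContinuousLinearMap.comp_apply, ContinuousLinearMap.adjoint_inner_right,
      inner_creation_vacEmb, zero_apply, inner_zero_right]
  conv_lhs => rw [hQ]
  rw [ContinuousLinearMap.comp_add, ← ContinuousLinearMap.comp_assoc, h0,
    ContinuousLinearMap.zero_comp, zero_add, ← ContinuousLinearMap.comp_assoc,
    adjoint_creation_creationOp, ContinuousLinearMap.comp_assoc]

/-- For η = 0 the vacuum embedding is an isometric kernel, because both sides of the creation
relation vanish. Evaluation at 0 is thus compression to the vacuum sector. -/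
theorem isKernel_vacEmb : IsKernel (0 : sigmaDual E σ) (vacEmb E σ) := by
  refine ⟨fun ξ => ?_, phiInf_vacEmb⟩
  ext1 h
  refine ext_inner_left ℂ fun f => ?_
  rw [ContinuousLinearMap.comp_apply, ContinuousLinearMap.adjoint_inner_right,
    inner_creation_vacEmb]
  simp

/-- The weighted Poisson kernel with defect operator `D` satisfies `Q⋆ Q = a`. -/
theorem gram_eq (hσ : σ 1 = 1) {η : sigmaDual E σ} (hη : ‖η‖ < 1) (a : commutant σ)
    {D : H →L[ℂ] H} (hD : ContinuousLinearMap.adjoint D ∘L D =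
      ((a - dualIp η (dualAct a η) : commutant σ) : H →L[ℂ] H)) {Q : intertwiners E σ}
    (hQ : Q.1 = vacEmb E σ ∘L D + creationOp Q ∘L η.1) : gram Q = a := by
  have hQapp : ∀ h, Q.1 h = vacEmb E σ (D h) + creationOp Q (η.1 h) := fun h =>
    congrArg (· h) hQ
  have hdc : ∀ m, σ m * (gram Q - a) = (gram Q - a) * σ m := fun m => by
    rw [mul_sub, sub_mul, gram_comm, commutant_comm]
  have hamp : amplify E (gram Q - (a : H →L[ℂ] H)) hdc =
      amplify E (gram Q) (gram_comm Q) - amplify E (a : H →L[ℂ] H) (commutant_comm a) :=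
    ITensor.clm_ext fun ξ h => by simp
  -- Expanding Q⋆Q orthogonally gives D⋆D + η⋆ (I ⊗ Q⋆Q) η, and D⋆D = a − η⋆ (I ⊗ a) η. So Δ = Q⋆Q −
  -- a satisfies Δ = η⋆ (I ⊗ Δ) η.
  have key : gram Q - a = ContinuousLinearMap.adjoint η.1 ∘L amplify E (gram Q - (a : H →L[ℂ] H)) hdc ∘L η.1 := by
    ext1 k
    refine ext_inner_left ℂ fun h => ?_
    have h1 : ⟪creationOp Q (η.1 h), vacEmb E σ (D k)⟫_ℂ = 0 := inner_creationOp_vacEmb _ _ _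
    have h2 : ⟪vacEmb E σ (D h), creationOp Q (η.1 k)⟫_ℂ = 0 := by
      rw [← inner_conj_symm, inner_creationOp_vacEmb, map_zero]
    have h3 : ⟪D h, D k⟫_ℂ = ⟪h, ((a - dualIp η (dualAct a η) : commutant σ) : H →L[ℂ] H) k⟫_ℂ := by
      rw [← hD, ContinuousLinearMap.comp_apply, ContinuousLinearMap.adjoint_inner_right]
    have h4 : ⟪h, ((a - dualIp η (dualAct a η) : commutant σ) : H →L[ℂ] H) k⟫_ℂ = ⟪h, (a : H →L[ℂ] H) k⟫_ℂ -
        ⟪η.1 h, amplify E (a : H →L[ℂ] H) (commutant_comm a) (η.1 k)⟫_ℂ := by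
      rw [← inner_dualIp_dualAct, ← inner_sub_right]
      rfl
    rw [ContinuousLinearMap.comp_apply, ContinuousLinearMap.adjoint_inner_right,
      ContinuousLinearMap.comp_apply, hamp, sub_apply, sub_apply, inner_sub_right,
      inner_sub_right, inner_gram, hQapp, hQapp, inner_add_left, inner_add_right, inner_add_right,
      h1, h2, inner_vacEmb hσ, h3, h4, inner_creationOp]
    ring
  -- Taking norms gives ‖Δ‖ ≤ ‖η‖² ‖Δ‖, which forces Δ = 0 since ‖η‖ < 1. No series for `Q` needs to
  -- be summed.
  have hn : ‖gram Q - (a : H →L[ℂ] H)‖ ≤ ‖η‖ * ‖η‖ * ‖gram Q - (a : H →L[ℂ] H)‖ := by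
    have hηn : ‖η‖ = ‖η.1‖ := rfl
    conv_lhs => rw [key]
    refine (ContinuousLinearMap.opNorm_comp_le _ _).trans ?_
    rw [LinearIsometryEquiv.norm_map, hηn]
    calc _ ≤ ‖η.1‖ * (‖gram Q - (a : H →L[ℂ] H)‖ * ‖η.1‖) := by
          gcongr
          refine (ContinuousLinearMap.opNorm_comp_le _ _).trans ?_
          gcongr
          exact norm_amplify_opNorm_le _ hdc
      _ = _ := by ring
  have hlt : ‖η‖ * ‖η‖ < 1 := by nlinarith [norm_nonneg η]
  have : ‖gram Q - (a : H →L[ℂ] H)‖ = 0 := by nlinarith [norm_nonneg (gram Q - (a : H →L[ℂ] H))]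
  exact sub_eq_zero.1 (norm_eq_zero.1 this)

/-- The weighted Poisson kernel: if `⟨η, a · η⟩ ≤ a`, there is a kernel `Q` with `Q⋆ Q = a`. -/
theorem exists_kernel (hσ : σ 1 = 1) {η : sigmaDual E σ} (hη : ‖η‖ < 1) (a : commutant σ)
    (ha : (dualIp η (dualAct a η) : H →L[ℂ] H) ≤ a) :
    ∃ (Q : intertwiners E σ) (D : H →L[ℂ] H),
      Q.1 = vacEmb E σ ∘L D + creationOp Q ∘L η.1 ∧ gram Q = a := by
  -- `D` is the defect operator. It lies in σ(M)', which is what makes `vacEmb E σ ∘L D` an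
  -- intertwiner.
  obtain ⟨D, hDc, hD⟩ := exists_sqrt (a - dualIp η (dualAct a η)) (sub_nonneg.2 ha)
  have hv : vacEmb E σ ∘L D ∈ intertwiners E σ := fun m => by
    rw [← ContinuousLinearMap.comp_assoc, phiInf_vacEmb, ContinuousLinearMap.comp_assoc,
      ContinuousLinearMap.comp_assoc]
    exact congrArg _ (hDc m)
  -- The solution is the Neumann series of `creationMap η` applied to the vacuum term; its n-th term
  -- lives in degree n of the Fock space.
  obtain ⟨Q, hQ⟩ := exists_eq_add_of_norm_le (X := H) (G := ITensor M (Fock M E) σ)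
    (intertwiners E σ) isClosed_intertwiners (creationMap η) hη (norm_creationMap_le η) ⟨vacEmb E σ ∘L D, hv⟩
  have hQ' : Q.1 = vacEmb E σ ∘L D + creationOp Q ∘L η.1 := congrArg Subtype.val hQ
  exact ⟨Q, D, hQ', gram_eq hσ hη a hD hQ'⟩

end Kernel

/-! ### Closedness arguments and the operator order. -/

section Auxiliary

theorem closure_subset_of_isClosed {A : Type v} {t : TopologicalSpace A} {U S : Set A}
    (hS : IsClosed[t] S) (hU : U ⊆ S) : closure[t] U ⊆ S :=
  closure_minimal hU hS

theorem isClosed_forall_eq {A : Type v} {t : TopologicalSpace A} {ι : Type w} {f g : ι → A → ℂ}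
    (hf : ∀ i, Continuous[t, inferInstance] (f i)) (hg : ∀ i, Continuous[t, inferInstance] (g i)) :
    IsClosed[t] {X | ∀ i, f i X = g i X} := by
  simp only [Set.ofPred_forall]
  exact isClosed_iInter fun i => isClosed_eq (hf i) (hg i)

/-- The bounded linear map `X ↦ S τ(X) P`. -/
def sandwich {A : Type*} [SeminormedAddCommGroup A] [NormedSpace ℂ A] {G : Type*}
    [NormedAddCommGroup G] [NormedSpace ℂ G] {H : Type*} [NormedAddCommGroup H] [NormedSpace ℂ H]
    (τ : A →L[ℂ] (G →L[ℂ] G)) (S : G →L[ℂ] H) (P : H →L[ℂ] G) : A →L[ℂ] (H →L[ℂ] H) :=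
  (ContinuousLinearMap.compL ℂ H G H S) ∘L ((ContinuousLinearMap.compL ℂ H G G).flip P) ∘L τ

/-- Over ℂ, an operator whose quadratic form is real and nonnegative is positive, self-adjointness
being automatic; diagonal values therefore decide the order. -/
theorem le_of_inner_eq {H : Type w} [NormedAddCommGroup H] [InnerProductSpace ℂ H]
    {S T : H →L[ℂ] H} (s t : H → ℝ) (hS : ∀ h, ⟪h, S h⟫_ℂ = s h)
    (hT : ∀ h, ⟪h, T h⟫_ℂ = t h) (hst : ∀ h, s h ≤ t h) : S ≤ T := by
  rw [ContinuousLinearMap.le_def, ContinuousLinearMap.isPositive_iff_complex]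
  intro h
  have h1 : ⟪(T - S) h, h⟫_ℂ = ((t h - s h : ℝ) : ℂ) := by
    rw [← inner_conj_symm, sub_apply, inner_sub_right, hS, hT, ← Complex.ofReal_sub,
      Complex.conj_ofReal]
  rw [h1]
  exact ⟨rfl, by simpa using hst h⟩

end Auxiliary

/-! ### From the generators to the Hardy algebra. -/

section Schwarz
variable {K : Type u} [NormedAddCommGroup K] [InnerProductSpace ℂ K] [CompleteSpace K]
variable {M : VonNeumannAlgebra K} {E : Type u} [NormedAddCommGroup E] [NormedSpace ℂ E]
  [CompleteSpace E] [WStarCorrespondence M E]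
  {H : Type w} [NormedAddCommGroup H] [InnerProductSpace ℂ H] [CompleteSpace H]
  {σ : Elem M →⋆ₙₐ[ℂ] (H →L[ℂ] H)}
open HilbertModule TensorProduct WStarCorrespondence

variable (M E) in
/-- The algebra generated by `φ_∞(M)` and the creation operators. -/
abbrev polyAlg : NonUnitalSubalgebra ℂ (Adjointable M (Fock M E)) :=
  NonUnitalAlgebra.adjoin ℂ (Set.range (phiInf (M := M) E) ∪ Set.range (creation M (E := E)))

/-- An ultraweakly closed set that contains the generated algebra contains `H^∞(E)`. -/
theorem hardy_subset {S : Set (Adjointable M (Fock M E))}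
    (hS : IsClosed[ultraweakAdj M (Fock M E)] S) (h : ∀ X ∈ polyAlg M E, X ∈ S)
    {X : Adjointable M (Fock M E)} (hX : X ∈ hardy M E) : X ∈ S := by
  -- Two closures are taken: `S` absorbs the norm closure because the norm topology is finer, and
  -- then the ultraweak closure.
  exact closure_subset_of_isClosed hS
    (closure_subset_of_isClosed (hS.mono le_weakTopology) h) hX

/-- This identifies an operator `r`, known only through an intertwining relation, as the compression
to the range of the isometry `P`. -/
theorem compression_eq {P : H →L[ℂ] ITensor M (Fock M E) σ}
    (hP1 : ContinuousLinearMap.adjoint P ∘L P = 1)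
    {R : ITensor M (Fock M E) σ →L[ℂ] ITensor M (Fock M E) σ} {r : H →L[ℂ] H}
    (h : ContinuousLinearMap.adjoint P ∘L R = r ∘L ContinuousLinearMap.adjoint P) :
    ContinuousLinearMap.adjoint P ∘L R ∘L P = r := by
  rw [← ContinuousLinearMap.comp_assoc, h, ContinuousLinearMap.comp_assoc, hP1]
  rfl

theorem IsKernel.adjoint_creation {η : sigmaDual E σ} {Q : H →L[ℂ] ITensor M (Fock M E) σ}
    (hQ : IsKernel η Q) (ξ : E) : ContinuousLinearMap.adjoint Q ∘L tensorOp σ (Hardy.creation M ξ) =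
      (ContinuousLinearMap.adjoint η.1 ∘L tensorLeft σ ξ) ∘L ContinuousLinearMap.adjoint Q := by
  have := congrArg ContinuousLinearMap.adjoint (hQ.creation ξ)
  rwa [ContinuousLinearMap.adjoint_comp, ContinuousLinearMap.adjoint_adjoint,
    ContinuousLinearMap.adjoint_comp, ContinuousLinearMap.adjoint_comp,
    ContinuousLinearMap.adjoint_adjoint] at this

theorem IsKernel.adjoint_phi {η : sigmaDual E σ} {Q : H →L[ℂ] ITensor M (Fock M E) σ}
    (hQ : IsKernel η Q) (a : Elem M) : ContinuousLinearMap.adjoint Q ∘L tensorOp σ (phiInf E a) =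
      σ a ∘L ContinuousLinearMap.adjoint Q := by
  have := congrArg ContinuousLinearMap.adjoint (hQ.phi (star a))
  rwa [ContinuousLinearMap.adjoint_comp, adjoint_phiInf, star_star,
    ContinuousLinearMap.adjoint_comp, map_star σ, ContinuousLinearMap.star_eq_adjoint,
    ContinuousLinearMap.adjoint_adjoint] at this

/-- Every kernel for `η` intertwines the compression to an isometric kernel for `η`. -/
theorem IsKernel.adjoint_comp (hσ : IsFaithfulNormal σ) {η : sigmaDual E σ}
    {P Q : H →L[ℂ] ITensor M (Fock M E) σ} (hP : IsKernel η P)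
    (hP1 : ContinuousLinearMap.adjoint P ∘L P = 1) (hQ : IsKernel η Q)
    {X : Adjointable M (Fock M E)} (hX : X ∈ hardy M E) :
    ContinuousLinearMap.adjoint Q ∘L tensorOp σ X =
      (ContinuousLinearMap.adjoint P ∘L tensorOp σ X ∘L P) ∘L ContinuousLinearMap.adjoint Q := by
  refine hardy_subset (S := {X | ContinuousLinearMap.adjoint Q ∘L tensorOp σ X =
    (ContinuousLinearMap.adjoint P ∘L tensorOp σ X ∘L P) ∘L ContinuousLinearMap.adjoint Q})
    ?_ (fun X hX => ?_) hX
  -- Rewritten in matrix coefficients of X ⊗ I between fixed vectors, the condition is visibly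
  -- ultraweakly closed.
  · have : {X | ContinuousLinearMap.adjoint Q ∘L tensorOp σ X =
        (ContinuousLinearMap.adjoint P ∘L tensorOp σ X ∘L P) ∘L ContinuousLinearMap.adjoint Q} =
        {X | ∀ i : H × ITensor M (Fock M E) σ, ⟪Q i.1, tensorOp σ X i.2⟫_ℂ =
          ⟪P i.1, tensorOp σ X (P (ContinuousLinearMap.adjoint Q i.2))⟫_ℂ} := by
      ext X
      simp only [Set.mem_ofPred_eq]
      constructor
      · rintro hX ⟨h, f⟩
        rw [← ContinuousLinearMap.adjoint_inner_right, ← ContinuousLinearMap.adjoint_inner_right]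
        exact congrArg (fun T => ⟪h, T f⟫_ℂ) hX
      · intro hX
        ext1 f
        refine ext_inner_left ℂ fun h => ?_
        have := hX (h, f)
        rwa [← ContinuousLinearMap.adjoint_inner_right,
          ← ContinuousLinearMap.adjoint_inner_right] at this
    rw [this]
    exact isClosed_forall_eq (fun _ => continuous_inner_tensorOp hσ.normal _ _)
      (fun _ => continuous_inner_tensorOp hσ.normal _ _)
  -- The induction carries a single `r` that serves both `P` and `Q`. Such pairs are stable under
  -- sums, scalars and products, and `compression_eq` for `P` determines `r` at the end.
  · have : ∃ r : H →L[ℂ] H,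
        ContinuousLinearMap.adjoint P ∘L tensorOp σ X = r ∘L ContinuousLinearMap.adjoint P ∧
        ContinuousLinearMap.adjoint Q ∘L tensorOp σ X = r ∘L ContinuousLinearMap.adjoint Q := by
      refine NonUnitalAlgebra.adjoin_induction (p := fun X _ => ∃ r : H →L[ℂ] H,
        ContinuousLinearMap.adjoint P ∘L tensorOp σ X = r ∘L ContinuousLinearMap.adjoint P ∧
        ContinuousLinearMap.adjoint Q ∘L tensorOp σ X = r ∘L ContinuousLinearMap.adjoint Q)
        ?_ ?_ ?_ ?_ ?_ hX
      · rintro _ (⟨a, rfl⟩ | ⟨ξ, rfl⟩)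
        · exact ⟨_, hP.adjoint_phi a, hQ.adjoint_phi a⟩
        · exact ⟨_, hP.adjoint_creation ξ, hQ.adjoint_creation ξ⟩
      · rintro X Y - - ⟨r, h1, h2⟩ ⟨s, h3, h4⟩
        refine ⟨r + s, ?_, ?_⟩ <;>
        rw [← tensorOpL_apply, map_add, tensorOpL_apply, tensorOpL_apply,
          ContinuousLinearMap.comp_add, ContinuousLinearMap.add_comp]
        · rw [h1, h3]
        · rw [h2, h4]
      · refine ⟨0, ?_, ?_⟩ <;> rw [← tensorOpL_apply, map_zero] <;> simp
      · rintro X Y - - ⟨r, h1, h2⟩ ⟨s, h3, h4⟩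
        refine ⟨r ∘L s, ?_, ?_⟩ <;> rw [tensorOp_mul, ← ContinuousLinearMap.comp_assoc]
        · rw [h1, ContinuousLinearMap.comp_assoc, h3, ContinuousLinearMap.comp_assoc]
        · rw [h2, ContinuousLinearMap.comp_assoc, h4, ContinuousLinearMap.comp_assoc]
      · rintro c X - ⟨r, h1, h2⟩
        refine ⟨c • r, ?_, ?_⟩ <;>
        rw [← tensorOpL_apply, map_smul, tensorOpL_apply,
          ContinuousLinearMap.comp_smul, ContinuousLinearMap.smul_comp]
        · rw [h1]
        · rw [h2]
    obtain ⟨r, h1, h2⟩ := this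
    show _ = _
    rw [compression_eq hP1 h1, h2]

/-! ### The representation ρ_η as a compression, and its uniqueness. -/

/-- The compression `X ↦ P⋆ (X ⊗ I) P`. -/
def compressionL (P : H →L[ℂ] ITensor M (Fock M E) σ) :
    Adjointable M (Fock M E) →L[ℂ] (H →L[ℂ] H) :=
  sandwich (tensorOpL σ) (ContinuousLinearMap.adjoint P) P

theorem compressionL_apply (P : H →L[ℂ] ITensor M (Fock M E) σ) (X : Adjointable M (Fock M E)) :
    compressionL P X = ContinuousLinearMap.adjoint P ∘L tensorOp σ X ∘L P := rfl

theorem continuous_compressionL (hσ : IsFaithfulNormal σ)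
    (P : H →L[ℂ] ITensor M (Fock M E) σ) :
    Continuous[ultraweakAdj M (Fock M E), ultraweak H] (compressionL P) := by
  refine continuous_weakTopology_of_comp_mem (compressionL P) fun f hf => ?_
  obtain ⟨h, k, hf⟩ := hf
  have : f ∘L compressionL P = vectorFunctional (tensorOpL σ) (P h) (P k) := by
    ext1 X
    rw [ContinuousLinearMap.comp_apply, hf, compressionL_apply, ContinuousLinearMap.comp_apply,
      ContinuousLinearMap.adjoint_inner_right]
    rfl
  rw [this]
  exact vectorFunctional_tensorOpL_mem hσ.normal _ _

/-- The compression to the range of an isometric kernel, as a homomorphism on `H^∞(E)`. -/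
def kernelRep (hσ : IsFaithfulNormal σ) {η : sigmaDual E σ}
    {P : H →L[ℂ] ITensor M (Fock M E) σ} (hP : IsKernel η P)
    (hP1 : ContinuousLinearMap.adjoint P ∘L P = 1) : hardy M E →ₙₐ[ℂ] (H →L[ℂ] H) where
  toFun X := compressionL P X
  map_smul' c X := map_smul (compressionL P) c X.1
  map_zero' := map_zero (compressionL P)
  map_add' X Y := map_add (compressionL P) X.1 Y.1
  -- The relation P⋆ (X ⊗ I) = (P⋆ (X ⊗ I) P) P⋆, which is `IsKernel.adjoint_comp` with Q = P,
  -- inserts the missing projection PP⋆ between X ⊗ I and Y ⊗ I.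
  map_mul' X Y := by
    show compressionL P (X.1 * Y.1) = compressionL P X.1 ∘L compressionL P Y.1
    simp only [compressionL_apply, tensorOp_mul]
    rw [← ContinuousLinearMap.comp_assoc, ← ContinuousLinearMap.comp_assoc,
      hP.adjoint_comp hσ hP1 hP X.2]
    rfl

theorem isIntegratedForm_kernelRep (hσ : IsFaithfulNormal σ) {η : sigmaDual E σ}
    {P : H →L[ℂ] ITensor M (Fock M E) σ} (hP : IsKernel η P)
    (hP1 : ContinuousLinearMap.adjoint P ∘L P = 1) :
    IsIntegratedForm σ η (kernelRep hσ hP hP1) where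
  map_creation ξ := compression_eq hP1 (hP.adjoint_creation ξ)
  map_phi a := compression_eq hP1 (hP.adjoint_phi a)
  continuous := @Continuous.comp _ _ _
    (TopologicalSpace.induced Subtype.val (ultraweakAdj M (Fock M E)))
    (ultraweakAdj M (Fock M E)) (ultraweak H) _ _ (continuous_compressionL hσ P)
    continuous_induced_dom

theorem IsIntegratedForm.unique {η : sigmaDual E σ} {ρ₁ ρ₂ : hardy M E →ₙₐ[ℂ] (H →L[ℂ] H)}
    (h₁ : IsIntegratedForm σ η ρ₁) (h₂ : IsIntegratedForm σ η ρ₂) : ρ₁ = ρ₂ := by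
  have hc : ∀ (h k : H) {ρ : hardy M E →ₙₐ[ℂ] (H →L[ℂ] H)}, IsIntegratedForm σ η ρ →
      Continuous[TopologicalSpace.induced Subtype.val (ultraweakAdj M (Fock M E)),
        inferInstance] fun X => ⟪h, ρ X k⟫_ℂ := fun h k ρ hρ =>
    @Continuous.comp _ _ _ (TopologicalSpace.induced Subtype.val (ultraweakAdj M (Fock M E)))
      (ultraweak H) _ _ _
      (continuous_weakTopology_apply (f := innerSL ℂ h ∘L ContinuousLinearMap.apply ℂ _ k)
        (subset_predual ⟨h, k, fun _ => rfl⟩)) hρ.continuous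
  have hcl : IsClosed[TopologicalSpace.induced Subtype.val (ultraweakAdj M (Fock M E))]
      {X : hardy M E | ρ₁ X = ρ₂ X} := by
    have : {X : hardy M E | ρ₁ X = ρ₂ X} =
        {X | ∀ i : H × H, ⟪i.1, ρ₁ X i.2⟫_ℂ = ⟪i.1, ρ₂ X i.2⟫_ℂ} := by
      ext X
      simp only [Set.mem_ofPred_eq]
      exact ⟨fun hX i => by rw [hX], fun hX => ContinuousLinearMap.ext fun k =>
        ext_inner_left ℂ fun h => hX (h, k)⟩
    rw [this]
    exact isClosed_forall_eq (fun i => hc i.1 i.2 h₁) (fun i => hc i.1 i.2 h₂)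
  -- The set of agreement is closed only relative to H^∞(E). Writing it as the trace of a closed set
  -- `S` of the ambient algebra lets `hardy_subset` apply.
  obtain ⟨S, hS, hS'⟩ := (@isClosed_induced_iff _ _ (ultraweakAdj M (Fock M E)) _ _).1 hcl
  have hpoly : polyAlg M E ≤
      (NonUnitalAlgHom.equalizer ρ₁ ρ₂).map (NonUnitalSubalgebraClass.subtype (hardy M E)) := by
    refine NonUnitalAlgebra.adjoin_le ?_
    rintro _ (⟨a, rfl⟩ | ⟨ξ, rfl⟩)
    · exact ⟨hardyPhi M E a, (h₁.map_phi a).trans (h₂.map_phi a).symm, rfl⟩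
    · exact ⟨hardyCreation M ξ, (h₁.map_creation ξ).trans (h₂.map_creation ξ).symm, rfl⟩
  refine NonUnitalAlgHom.ext fun X => ?_
  have hX : X.1 ∈ S := hardy_subset hS (fun Y hY => by
    obtain ⟨Z, hZ, rfl⟩ := hpoly hY
    have : Z ∈ Subtype.val ⁻¹' S := hS'.symm ▸ hZ
    exact this) X.2
  have hX' : X ∈ Subtype.val ⁻¹' S := hX
  rw [hS'] at hX'
  exact hX'

/-- `integratedForm` is defined by choice; uniqueness makes the choice harmless, and any isometric
kernel computes the value. -/
theorem pointEval_eq (hσ : IsFaithfulNormal σ) {η : sigmaDual E σ}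
    {P : H →L[ℂ] ITensor M (Fock M E) σ} (hP : IsKernel η P)
    (hP1 : ContinuousLinearMap.adjoint P ∘L P = 1) (X : hardy M E) :
    pointEval σ X η = ContinuousLinearMap.adjoint P ∘L tensorOp σ X.1 ∘L P := by
  have h : ∃ ρ, IsIntegratedForm σ η ρ := ⟨_, isIntegratedForm_kernelRep hσ hP hP1⟩
  have h1 : integratedForm σ η = kernelRep hσ hP hP1 := by
    rw [integratedForm, dif_pos h]
    exact h.choose_spec.unique (isIntegratedForm_kernelRep hσ hP hP1)
  rw [pointEval, h1]
  rfl

/-! ### The positive map a ↦ ⟨η, a · η⟩ and its iterates. -/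

/-- The completely positive map `a ↦ ⟨η, a · η⟩` on `σ(M)'`. -/
def dualMap (η : sigmaDual E σ) (a : commutant σ) : commutant σ := dualIp η (dualAct a η)

theorem amplify_sub (a b : commutant σ) :
    amplify E ((b - a : commutant σ) : H →L[ℂ] H) (commutant_comm (b - a)) =
      amplify E (b : H →L[ℂ] H) (commutant_comm b) -
        amplify E (a : H →L[ℂ] H) (commutant_comm a) :=
  ITensor.clm_ext fun ξ h => by simp

/-- Writing a = D⋆D with D in σ(M)', one has I ⊗ a = (I ⊗ D)⋆ (I ⊗ D), so the quadratic form at `h`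
is ‖(I ⊗ D) η h‖². -/
theorem dualMap_nonneg (η : sigmaDual E σ) {a : commutant σ} (ha : 0 ≤ (a : H →L[ℂ] H)) :
    0 ≤ (dualMap η a : H →L[ℂ] H) := by
  obtain ⟨D, hDc, hD⟩ := exists_sqrt a ha
  refine le_of_inner_eq (fun _ => 0) (fun h => ‖amplify E D hDc (η.1 h)‖ ^ 2) (by simp)
    (fun h => ?_) fun h => by positivity
  have h1 : ContinuousLinearMap.adjoint (amplify E D hDc) ∘L amplify E D hDc =
      amplify E (a : H →L[ℂ] H) (commutant_comm a) := by
    refine ITensor.clm_ext fun ξ h => ITensor.ext_inner fun ζ k => ?_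
    have h2 : ∀ m x, D (σ m x) = σ m (D x) := fun m x => congrArg (· x) (hDc m).symm
    have h3 : ∀ m x, (a : H →L[ℂ] H) (σ m x) = σ m ((a : H →L[ℂ] H) x) := fun m x =>
      congrArg (· x) (commutant_comm a m).symm
    rw [ContinuousLinearMap.comp_apply, ContinuousLinearMap.adjoint_inner_right,
      amplify_tensorLeft, amplify_tensorLeft, amplify_tensorLeft, inner_tensorLeft,
      inner_tensorLeft, ← h2, ← h3, ← hD, ContinuousLinearMap.comp_apply,
      ContinuousLinearMap.adjoint_inner_right]
  rw [dualMap, inner_dualIp_dualAct, ← h1, ContinuousLinearMap.comp_apply,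
    ContinuousLinearMap.adjoint_inner_right, inner_self_eq_norm_sq_to_K]
  push_cast
  rfl

theorem dualMap_mono (η : sigmaDual E σ) {a b : commutant σ}
    (hab : (a : H →L[ℂ] H) ≤ b) : (dualMap η a : H →L[ℂ] H) ≤ dualMap η b := by
  have h := dualMap_nonneg η (a := b - a) (sub_nonneg.2 hab)
  have h1 : (dualMap η (b - a) : H →L[ℂ] H) = dualMap η b - dualMap η a := by
    ext1 k
    refine ext_inner_left ℂ fun h => ?_
    rw [sub_apply, inner_sub_right]
    simp only [dualMap]
    rw [inner_dualIp_dualAct, inner_dualIp_dualAct, inner_dualIp_dualAct, amplify_sub, sub_apply,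
      inner_sub_right]
  rw [h1] at h
  exact sub_nonneg.1 h

theorem dualMap_one (η : sigmaDual E σ) : dualMap η 1 = dualIp η η := by
  have : amplify E ((1 : commutant σ) : H →L[ℂ] H) (commutant_comm 1) =
      ContinuousLinearMap.id ℂ (ITensor M E σ) :=
    ITensor.clm_ext fun ξ h => by simp
  refine congrArg (dualIp η) (Subtype.ext ?_)
  show amplify E ((1 : commutant σ) : H →L[ℂ] H) (commutant_comm 1) ∘L η.1 = η.1
  rw [this, ContinuousLinearMap.id_comp]

theorem dualMap_one_le {η : sigmaDual E σ} (hη : ‖η‖ ≤ 1) :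
    (dualMap η 1 : H →L[ℂ] H) ≤ (1 : commutant σ) := by
  rw [dualMap_one]
  refine le_of_inner_eq (fun h => ‖η.1 h‖ ^ 2) (fun h => ‖h‖ ^ 2) (fun h => ?_) (fun h => ?_)
    fun h => ?_
  · show ⟪h, ContinuousLinearMap.adjoint η.1 (η.1 h)⟫_ℂ = _
    rw [ContinuousLinearMap.adjoint_inner_right, inner_self_eq_norm_sq_to_K]
    push_cast
    rfl
  · show ⟪h, h⟫_ℂ = _
    rw [inner_self_eq_norm_sq_to_K]
    push_cast
    rfl
  · gcongr
    exact (η.1.le_of_opNorm_le hη h).trans_eq (one_mul _)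

/-- The recursion of `tensorIp` consumes one tensor factor by updating its last argument, which for
equal factors is one application of `dualMap η`. -/
theorem tensorIp_const (η : sigmaDual E σ) (k : ℕ) (b : commutant σ) :
    tensorIp k (fun _ => η) (fun _ => η) b = (dualMap η)^[k] b := by
  induction k generalizing b with
  | zero => rfl
  | succ k ih => exact ih (dualMap η b)

theorem powIp_succ (η : sigmaDual E σ) (k : ℕ) : powIp η (k + 1) = dualMap η (powIp η k) := by
  rw [powIp, powIp, tensorIp_const, tensorIp_const, Function.iterate_succ_apply']

/-- From Φ(1) ≤ 1, monotonicity of Φ gives Φᵏ⁺¹(1) ≤ Φᵏ(1). This is the condition that makes Φᵏ(1)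
an admissible weight for a Poisson kernel. -/
theorem powIp_succ_le {η : sigmaDual E σ} (hη : ‖η‖ ≤ 1) (k : ℕ) :
    (powIp η (k + 1) : H →L[ℂ] H) ≤ powIp η k := by
  induction k with
  | zero => rw [powIp_succ]; exact dualMap_one_le hη
  | succ k ih =>
    have h := dualMap_mono η ih
    rwa [← powIp_succ, ← powIp_succ] at h

/-! ### The Schwarz inequality. -/

theorem exists_isometric_kernel (hσ : IsFaithfulNormal σ) {η : sigmaDual E σ} (hη : ‖η‖ < 1) :
    ∃ P : H →L[ℂ] ITensor M (Fock M E) σ, IsKernel η P ∧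
      ContinuousLinearMap.adjoint P ∘L P = 1 := by
  obtain ⟨P, D, h1, h2⟩ := exists_kernel hσ.map_one hη 1 (dualMap_one_le hη.le)
  exact ⟨P.1, isKernel_of_eq h1, h2⟩

/-- An element of `H^∞(E)` vanishing at `0` has no component in the vacuum sector. -/
theorem adjoint_tensorOp_vacEmb (hσ : IsFaithfulNormal σ) {X : hardy M E}
    (hX : pointEval σ X (0 : sigmaDual E σ) = 0) :
    ContinuousLinearMap.adjoint (tensorOp σ X.1) ∘L vacEmb E σ = 0 := by
  have hv1 : ContinuousLinearMap.adjoint (vacEmb E σ) ∘L vacEmb E σ = 1 := by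
    ext1 k
    refine ext_inner_left ℂ fun h => ?_
    rw [ContinuousLinearMap.comp_apply, ContinuousLinearMap.adjoint_inner_right,
      inner_vacEmb hσ.map_one]
    rfl
  -- With both kernels equal to the vacuum embedding V, the relation reads V⋆ (X ⊗ I) = X(0) V⋆, and
  -- the right side is zero.
  have h := isKernel_vacEmb.adjoint_comp hσ hv1 isKernel_vacEmb X.2
  rw [← pointEval_eq hσ isKernel_vacEmb hv1, hX, ContinuousLinearMap.zero_comp] at h
  have h2 := congrArg ContinuousLinearMap.adjoint h
  rwa [ContinuousLinearMap.adjoint_comp, ContinuousLinearMap.adjoint_adjoint, map_zero] at h2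

/-- The isometric kernel `P` gives the value X(η⋆), while the kernel `Q` weighted by `a` gives the
inequality. Both intertwine the same operator X(η⋆), which is why the weight `a` can be inserted. -/
theorem pointEval_schwarz (hσ : IsFaithfulNormal σ) {X : hardy M E} (hX : ‖X‖ ≤ 1)
    (hX0 : pointEval σ X (0 : sigmaDual E σ) = 0) {η : sigmaDual E σ} (hη : ‖η‖ < 1)
    {a : commutant σ} (ha : (dualMap η a : H →L[ℂ] H) ≤ a) :
    pointEval σ X η * a * star (pointEval σ X η) ≤ dualMap η a := by
  obtain ⟨P, hP, hP1⟩ := exists_isometric_kernel hσ hη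
  obtain ⟨Q, D, hQ, hQa⟩ := exists_kernel hσ.map_one hη a ha
  set r := pointEval σ X η with hr
  have hcomm : ContinuousLinearMap.adjoint Q.1 ∘L tensorOp σ X.1 =
      r ∘L ContinuousLinearMap.adjoint Q.1 := by
    rw [hP.adjoint_comp hσ hP1 (isKernel_of_eq hQ) X.2, hr, pointEval_eq hσ hP hP1]
  have hadj := congrArg ContinuousLinearMap.adjoint hcomm
  rw [ContinuousLinearMap.adjoint_comp, ContinuousLinearMap.adjoint_comp,
    ContinuousLinearMap.adjoint_adjoint] at hadj
  -- Of the two summands of Q h, the vacuum one is killed by (X ⊗ I)⋆ because X(0) = 0. This gain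
  -- replaces the bound `a` by Φ(a).
  have hvec : ∀ h, Q.1 (ContinuousLinearMap.adjoint r h) =
      ContinuousLinearMap.adjoint (tensorOp σ X.1) (creationOp Q (η.1 h)) := fun h => by
    have h1 : ContinuousLinearMap.adjoint (tensorOp σ X.1) (Q.1 h) =
        Q.1 (ContinuousLinearMap.adjoint r h) := congrArg (· h) hadj
    have h2 : Q.1 h = vacEmb E σ (D h) + creationOp Q (η.1 h) := congrArg (· h) hQ
    have h3 : ContinuousLinearMap.adjoint (tensorOp σ X.1) (vacEmb E σ (D h)) = 0 :=
      congrArg (· (D h)) (adjoint_tensorOp_vacEmb hσ hX0)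
    rw [← h1, h2, map_add, h3, zero_add]
  refine le_of_inner_eq (fun h => ‖Q.1 (ContinuousLinearMap.adjoint r h)‖ ^ 2)
    (fun h => ‖creationOp Q (η.1 h)‖ ^ 2) (fun h => ?_) (fun h => ?_) fun h => ?_
  · show ⟪h, r ((a : H →L[ℂ] H) (ContinuousLinearMap.adjoint r h))⟫_ℂ = _
    rw [← ContinuousLinearMap.adjoint_inner_left, ← hQa, inner_gram, inner_self_eq_norm_sq_to_K]
    push_cast
    rfl
  -- Since Q⋆Q = a, the squared norm of C_Q η h is ⟨η h, (I ⊗ a) η h⟩.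
  · have h1 : amplify E (gram Q) (gram_comm Q) =
        amplify E (a : H →L[ℂ] H) (commutant_comm a) :=
      ITensor.clm_ext fun ξ k => by rw [amplify_tensorLeft, amplify_tensorLeft, hQa]
    rw [dualMap, inner_dualIp_dualAct, ← h1, ← inner_creationOp, inner_self_eq_norm_sq_to_K]
    push_cast
    rfl
  · rw [hvec]
    have hn : ‖ContinuousLinearMap.adjoint (tensorOp σ X.1)‖ ≤ 1 := by
      rw [LinearIsometryEquiv.norm_map]
      exact (norm_tensorOp_le X.1).trans hX
    gcongr
    exact (ContinuousLinearMap.le_of_opNorm_le _ hn _).trans_eq (one_mul _)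

end Schwarz
end Hardy
end
theorem theorem3p5 {K E : Type u} {H : Type w}
    [NormedAddCommGroup K] [InnerProductSpace ℂ K] [CompleteSpace K]
    [NormedAddCommGroup H] [InnerProductSpace ℂ H] [CompleteSpace H]
    [NormedAddCommGroup E] [NormedSpace ℂ E] [CompleteSpace E]
    (M : VonNeumannAlgebra K) [Hardy.WStarCorrespondence M E]
    (σ : Hardy.Elem M →⋆ₙₐ[ℂ] (H →L[ℂ] H)) (hσ : Hardy.IsFaithfulNormal σ) :
    (∀ η : Hardy.sigmaDual E σ, ‖η‖ < 1 → ∃! ρ, Hardy.IsIntegratedForm σ η ρ) ∧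
    ∀ X : Hardy.hardy M E, ‖X‖ ≤ 1 → Hardy.pointEval σ X 0 = 0 →
    ∀ η : Hardy.sigmaDual E σ, ‖η‖ < 1 →
      (∀ a : Hardy.commutant σ, 0 ≤ (a : H →L[ℂ] H) →
        (Hardy.dualIp η (Hardy.dualAct a η) : H →L[ℂ] H) ≤ a →
        Hardy.pointEval σ X η * a * star (Hardy.pointEval σ X η) ≤
          Hardy.dualIp η (Hardy.dualAct a η)) ∧
      (∀ k : ℕ, Hardy.pointEval σ X η * Hardy.powIp η k * star (Hardy.pointEval σ X η) ≤
        Hardy.powIp η (k + 1)) ∧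
      Hardy.pointEval σ X η * star (Hardy.pointEval σ X η) ≤ Hardy.dualIp η η := by
  refine ⟨fun η hη => ?_, fun X hX hX0 η hη => ⟨fun a _ ha => ?_, fun k => ?_, ?_⟩⟩
  · obtain ⟨P, hP, hP1⟩ := Hardy.exists_isometric_kernel hσ hη
    exact ⟨_, Hardy.isIntegratedForm_kernelRep hσ hP hP1,
      fun ρ hρ => hρ.unique (Hardy.isIntegratedForm_kernelRep hσ hP hP1)⟩
  · exact Hardy.pointEval_schwarz hσ hX hX0 hη ha
  -- The weight is a = Φᵏ(1); it is admissible because the iterates decrease.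
  · rw [Hardy.powIp_succ]
    refine Hardy.pointEval_schwarz hσ hX hX0 hη ?_
    rw [← Hardy.powIp_succ]
    exact Hardy.powIp_succ_le hη.le k
  -- The weight is a = 1, and Φ(1) = ⟨η, η⟩.
  · have h := Hardy.pointEval_schwarz hσ hX hX0 hη (Hardy.dualMap_one_le hη.le)
    rw [Hardy.dualMap_one] at h
    rwa [show ((1 : Hardy.commutant σ) : H →L[ℂ] H) = 1 from rfl, mul_one] at h
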